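/- **Theorem 3.** Let $\mathcal F$ be the Fourier transform $(\mathcal F f)(\xi)=\int f(x)e^{-2\pi i x\xi}\,dx$, extended to tempered distributions; let $\langle f,g\rangle=\int_{\mathbf R} f\,\overline{g}\,dx$; and for $k\in\mathcal S'(\mathbf R)$, $f\in\mathcal S(\mathbf R)$ let $(k\star f)(x)=k\bigl(f(x-\cdot)\bigr)$. Let $\nu\in\mathcal S'(\mathbf R)$ be a (complex) tempered distribution whose Fourier transform is a locally integrable function $\varphi$, and suppose that convolution with $\nu$ is positive and self-adjoint in the sense that $$\langle \nu\star\chi,\chi\rangle\ge 0,\qquad \langle\nu\star\chi_1,\chi_2\rangle=\langle\chi_1,\nu\star\chi_2\rangle\qquad\text{for all }\chi,\chi_1,\chi_2\in\mathcal S(\mathbf R).$$ A *solution* of $u_{tt}+\nu\star u=0$ is a family $u(t)\in\mathcal S'(\mathbf R)$, $t\in\mathbf R$, that is twice differentiable in $t$ (that is, $t\mapsto\langle u(t),\chi\rangle$ is differentiable for each $\chi\in\mathcal S(\mathbf R)$, with derivative given by tempered distributions $\partial_t u(t)$, and likewise $\partial_t u$), such that for each $t$ the Fourier transform of $u(t)$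 is a locally integrable function $\hat u(t)$; the convolution $\nu\star u(t)$ is a tempered distribution with Fourier transform the locally integrable function $\varphi\,\hat u(t)$; $\int_{-R}^{R}|\varphi\,\hat u(t)|\,d\xi$ is bounded for $|t|\le T$, for all $R,T>0$; and $u_{tt}(t)=-\nu\star u(t)$ for all $t$. Then there are families of tempered distributions $k_0(t),k_{-1}(t)\in\mathcal S'(\mathbf R)$, $t\in\mathbf R$, such that for all initial data $u(0),\partial_tu(0)\in\mathcal S(\mathbf R)$ there is a unique solution, and it is given by $$u(t)=k_0(t)\star u(0)+k_{-1}(t)\star\partial_tu(0)\qquad(t\in\mathbf R).$$ Moreover, let $t>0$ and suppose that $k_{-1}(t)\ne0$ or that $\varphi$ is continuous. Then $k_0(t)$ and $k_{-1}(t)$ are not both of compact support, unless $$\nu=-(\alpha\delta''+i\beta\delta'+\gamma\delta)$$ with real $\alpha,\beta,\gamma$ such that either $\alpha=\beta=0$ and $\gamma\le0$, or $\alpha>0$ and $4\alpha\gamma+\beta^2\le0$; that is, unless the equation is really the differential equation $u_{tt}-\alpha u_{xx}-i\beta u_x-\gamma u=0$. -/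

import Mathlib

open MeasureTheory SchwartzMap FourierTransform
open scoped ComplexOrder

noncomputable section

namespace NonlocalWave

/-- For fixed `x`, the Schwartz function `y ↦ f (x - y)`. -/
def reflectAt (f : 𝓢(ℝ, ℂ)) (x : ℝ) : 𝓢(ℝ, ℂ) :=
  SchwartzMap.compSubConstCLM ℂ x
    (SchwartzMap.compCLMOfContinuousLinearEquiv ℂ (ContinuousLinearEquiv.neg ℝ) f)

theorem reflectAt_apply (f : 𝓢(ℝ, ℂ)) (x y : ℝ) : reflectAt f x y = f (x - y) := by
  simp [reflectAt]

/-- The convolution `k ⋆ f` of a tempered distribution with a Schwartz function, which is the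
function `x ↦ ⟨k, f (x - ·)⟩`. -/
def conv (k : 𝓢'(ℝ, ℂ)) (f : 𝓢(ℝ, ℂ)) (x : ℝ) : ℂ := k (reflectAt f x)

/-- The pairing `⟨f, g⟩ = ∫ f(x) conj(g(x)) dx`. -/
def pair (f g : ℝ → ℂ) : ℂ := ∫ x, f x * (starRingEnd ℂ) (g x)

/-- The tempered distribution `T` is (the regular distribution given by) the locally integrable
function `g`. Testing against compactly supported functions determines `T`, by density. -/
def IsFunction (T : 𝓢'(ℝ, ℂ)) (g : ℝ → ℂ) : Prop :=
  LocallyIntegrable g ∧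
    ∀ χ : 𝓢(ℝ, ℂ), HasCompactSupport χ → T χ = ∫ ξ, χ ξ * g ξ

/-- `w = ν ⋆ v` for tempered distributions `ν` and `v` whose Fourier transforms are functions:
the Fourier transform of `w` is the pointwise product of those of `ν` and `v` (which has to be
locally integrable). It determines `w`, because the functions are determined almost everywhere. -/
def IsConv (ν v w : 𝓢'(ℝ, ℂ)) : Prop :=
  ∃ φ g : ℝ → ℂ, IsFunction (𝓕 ν) φ ∧ IsFunction (𝓕 v) g ∧
    IsFunction (𝓕 w) (fun ξ => φ ξ * g ξ)

/-- The Fourier transforms of the `w t` are functions that are bounded in `L¹` on bounded sets,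
uniformly for `t` in bounded sets. -/
def FourierLocallyBounded (w : ℝ → 𝓢'(ℝ, ℂ)) : Prop :=
  ∀ T R : ℝ, ∃ C : ℝ, ∀ t ∈ Set.Icc (-T) T,
    ∃ h : ℝ → ℂ, IsFunction (𝓕 (w t)) h ∧ ∫ ξ in Set.Icc (-R) R, ‖h ξ‖ ≤ C

/-- `v` is the time derivative of the curve `u` of tempered distributions: for every Schwartz
function `χ`, the function `⟨u(t), χ⟩` is differentiable, with derivative `⟨v(t), χ⟩`. -/
def IsTimeDeriv (u v : ℝ → 𝓢'(ℝ, ℂ)) : Prop :=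
  ∀ (t : ℝ) (χ : 𝓢(ℝ, ℂ)), HasDerivAt (fun s => u s χ) (v t χ) t

/-- `u` solves `u_tt + ν ⋆ u = 0` with `u(0) = u₀` and `∂ₜu(0) = u₁`.
Here `v` is `∂ₜu` and `w` is `ν ⋆ u`. -/
def IsSolution (ν : 𝓢'(ℝ, ℂ)) (u₀ u₁ : 𝓢(ℝ, ℂ)) (u : ℝ → 𝓢'(ℝ, ℂ)) : Prop :=
  ∃ v w : ℝ → 𝓢'(ℝ, ℂ),
    IsTimeDeriv u v ∧ IsTimeDeriv v (fun t => -w t) ∧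
    (∀ t, IsConv ν (u t) (w t)) ∧ FourierLocallyBounded w ∧
    u 0 = SchwartzMap.toTemperedDistributionCLM ℝ ℂ volume u₀ ∧
    v 0 = SchwartzMap.toTemperedDistributionCLM ℝ ℂ volume u₁

/-- The tempered distribution `T` has compact support. -/
def CompactSupport (T : 𝓢'(ℝ, ℂ)) : Prop := IsCompact (Distribution.dsupport (T : 𝓢(ℝ, ℂ) → ℂ))

/-- The distribution `-(α δ'' + i β δ' + γ δ)`. -/
def diffKernel (α β γ : ℝ) : 𝓢'(ℝ, ℂ) :=
  -((α : ℂ) • TemperedDistribution.derivCLM ℂ (TemperedDistribution.derivCLM ℂ (TemperedDistribution.delta (0 : ℝ)))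
    + (Complex.I * (β : ℂ)) • TemperedDistribution.derivCLM ℂ (TemperedDistribution.delta (0 : ℝ))
    + (γ : ℂ) • TemperedDistribution.delta (0 : ℝ))

end NonlocalWave

end

/-!
After the Fourier transform in space the equation becomes the family of ordinary differential
equations `û_tt = -φ û`. Positivity makes `φ` nonnegative almost everywhere (`symbol_nonneg`), and a
nonnegative function that defines a tempered distribution is integrable against a power of
`1 / (1 + |ξ|)` (`isTempered_of_nonneg`). Hence the multipliers `cos (t √φ)` and `sin (t √φ) / √φ`,
which are bounded for each `t`, define `k₀(t)` and `k₋₁(t)`, and they produce a solution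
(`isSolution_fourierInv_solHat`).

Uniqueness (`isSolution_unique`) tests the difference of two solutions on the Fourier side against
compactly supported functions and exploits the local `L¹` bound on `φ û(t)`.

If `k₀(t)` and `k₋₁(t)` have compact support, their symbols extend to entire functions `C` and `S`
of exponential type (`exists_entire_of_compactSupport`). The identity `C² + φ S² = 1` then extends
`φ` to the meromorphic function `(1 - C²) / S²`, unless `S` vanishes identically. Moreover
`C = cos (t √φ)`, and a bound on `cos θ` bounds `|Im θ|`, hence bounds `Re θ²` from below. So
`Re φ` is bounded from below by a quadratic on the whole complex plane: `φ` cannot have poles, and it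
is a quadratic polynomial by the Borel–Carathéodory inequality (`exists_quadratic_of_entire`). Being
nonnegative on the real line, it has real coefficients and nonpositive discriminant, and its inverse
Fourier transform is the differential kernel. If `S` vanishes identically and `φ` is continuous,
then `√φ` takes values in a discrete set, so `φ` is constant (`exists_const_of_sinSymbol_eq_zero`).
-/

noncomputable section

namespace NonlocalWave

open Filter Topology
open scoped ContDiff Manifold

/-! ### Functions of tempered growth in the mean -/

/-- A function that is integrable against some inverse power of `1 + |x|`; it defines a tempered
distribution by integration. -/
def IsTempered (g : ℝ → ℂ) : Prop :=
  ∃ k : ℕ, Integrable (fun x => ((1 + |x|) ^ k)⁻¹ • g x)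

theorem IsTempered.aestronglyMeasurable {g : ℝ → ℂ} (hg : IsTempered g) :
    AEStronglyMeasurable g := by
  obtain ⟨k, hk⟩ := hg
  have h : AEStronglyMeasurable
      (fun x : ℝ => ((1 + |x|) ^ k) • (((1 + |x|) ^ k)⁻¹ • g x)) :=
    AEStronglyMeasurable.smul
      (by fun_prop : Measurable fun x : ℝ => (1 + |x|) ^ k).aestronglyMeasurable
      hk.aestronglyMeasurable
  refine h.congr (Eventually.of_forall fun x => ?_)
  have : (1 + |x|) ^ k ≠ 0 := by positivity
  simp only [smul_inv_smul₀ this]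

theorem IsTempered.mul_of_norm_le {g b : ℝ → ℂ} (hg : IsTempered g)
    (hb : AEStronglyMeasurable b) {B : ℝ} (hB : ∀ᵐ x, ‖b x‖ ≤ B) :
    IsTempered (fun x => b x * g x) := by
  obtain ⟨k, hk⟩ := hg
  refine ⟨k, (hk.bdd_mul hb hB).congr (Eventually.of_forall fun x => ?_)⟩
  simp only [Complex.real_smul]
  ring

theorem isTempered_of_norm_le {b : ℝ → ℂ} (hb : AEStronglyMeasurable b) {B : ℝ}
    (hB : ∀ᵐ x, ‖b x‖ ≤ B) : IsTempered b := by
  have h1 : IsTempered (fun _ : ℝ => (1 : ℂ)) := by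
    refine ⟨2, ?_⟩
    have h := integrable_one_add_norm (E := ℝ) (μ := volume) (r := 2) (by norm_num)
    refine (h.smul_const (1 : ℂ)).congr (Eventually.of_forall fun x => ?_)
    simp only [Real.norm_eq_abs]
    rw [Real.rpow_neg (by positivity)]
    norm_num
  simpa using h1.mul_of_norm_le hb hB

theorem norm_mul_one_add_pow_le (χ : 𝓢(ℝ, ℂ)) (k : ℕ) (x : ℝ) :
    (1 + |x|) ^ k * ‖χ x‖ ≤ 2 ^ k *
      (Finset.Iic (k, 0)).sup (schwartzSeminormFamily ℂ ℝ ℂ) χ := by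
  have := one_add_le_sup_seminorm_apply (𝕜 := ℂ) (m := (k, 0)) le_rfl le_rfl χ x
  rwa [norm_iteratedFDeriv_zero] at this

theorem norm_mul_le_seminorm (χ : 𝓢(ℝ, ℂ)) (g : ℝ → ℂ) (k : ℕ) (x : ℝ) :
    ‖χ x * g x‖ ≤ (2 ^ k * (Finset.Iic (k, 0)).sup (schwartzSeminormFamily ℂ ℝ ℂ) χ) *
      ‖((1 + |x|) ^ k)⁻¹ • g x‖ := by
  have hpos : 0 < (1 + |x|) ^ k := by positivity
  have h1 := norm_mul_one_add_pow_le χ k x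
  rw [norm_mul, norm_smul, norm_inv, Real.norm_of_nonneg hpos.le]
  calc ‖χ x‖ * ‖g x‖ = ((1 + |x|) ^ k * ‖χ x‖) * (((1 + |x|) ^ k)⁻¹ * ‖g x‖) := by
        field_simp
    _ ≤ _ := by gcongr

theorem IsTempered.integrable_mul {g : ℝ → ℂ} (hg : IsTempered g) (χ : 𝓢(ℝ, ℂ)) :
    Integrable (fun x => χ x * g x) := by
  have hm := hg.aestronglyMeasurable
  obtain ⟨k, hk⟩ := hg
  refine Integrable.mono' (hk.norm.const_mul
    (2 ^ k * (Finset.Iic (k, 0)).sup (schwartzSeminormFamily ℂ ℝ ℂ) χ))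
    (χ.continuous.aestronglyMeasurable.mul hm) (Eventually.of_forall fun x => ?_)
  exact norm_mul_le_seminorm χ g k x

theorem IsTempered.locallyIntegrable {g : ℝ → ℂ} (hg : IsTempered g) : LocallyIntegrable g := by
  obtain ⟨k, hk⟩ := hg
  have h := hk.locallyIntegrable.continuous_smul
    (g := fun x : ℝ => (1 + |x|) ^ k) (by fun_prop)
  refine h.congr (Eventually.of_forall fun x => ?_)
  have : (1 + |x|) ^ k ≠ 0 := by positivity
  simp only [smul_inv_smul₀ this]

theorem IsTempered.add {g h : ℝ → ℂ} (hg : IsTempered g) (hh : IsTempered h) :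
    IsTempered (fun x => g x + h x) := by
  have hgm := hg.aestronglyMeasurable
  have hhm := hh.aestronglyMeasurable
  obtain ⟨k, hk⟩ := hg
  obtain ⟨l, hl⟩ := hh
  have key : ∀ {f : ℝ → ℂ} {a b : ℕ}, AEStronglyMeasurable f → a ≤ b →
      Integrable (fun x => ((1 + |x|) ^ a)⁻¹ • f x) →
      Integrable (fun x => ((1 + |x|) ^ b)⁻¹ • f x) := by
    intro f a b hf hab hi
    refine hi.mono (AEStronglyMeasurable.smul
      (by fun_prop : Measurable fun x : ℝ => ((1 + |x|) ^ b)⁻¹).aestronglyMeasurable hf)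
      (Eventually.of_forall fun x => ?_)
    rw [norm_smul, norm_smul, norm_inv, norm_inv, Real.norm_of_nonneg (by positivity),
      Real.norm_of_nonneg (by positivity)]
    gcongr
    linarith [abs_nonneg x]
  refine ⟨max k l, ?_⟩
  simp only [smul_add]
  exact (key hgm (le_max_left k l) hk).add (key hhm (le_max_right k l) hl)

/-- The regular tempered distribution `χ ↦ ∫ χ g`. -/
def regDist (g : ℝ → ℂ) (hg : IsTempered g) : 𝓢'(ℝ, ℂ) :=
  ContinuousLinearMap.toPointwiseConvergenceCLM _ _ _ _ <|
    mkCLMtoNormedSpace (𝕜 := ℂ) (σ := RingHom.id ℂ) (fun χ : 𝓢(ℝ, ℂ) => ∫ x, χ x * g x)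
      (fun χ₁ χ₂ => by
        simp only [add_apply, add_mul]
        exact integral_add (hg.integrable_mul χ₁) (hg.integrable_mul χ₂))
      (fun a χ => by
        simp only [smul_apply, smul_eq_mul, mul_assoc, RingHom.id_apply]
        exact integral_const_mul _ _)
      (by
        obtain ⟨k, hk⟩ := hg
        refine ⟨Finset.Iic (k, 0), 2 ^ k * ∫ x, ‖((1 + |x|) ^ k)⁻¹ • g x‖,
          mul_nonneg (by positivity) (integral_nonneg fun x => norm_nonneg _), fun χ => ?_⟩
        refine (norm_integral_le_of_norm_le (hk.norm.const_mul _)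
          (Eventually.of_forall (norm_mul_le_seminorm χ g k))).trans ?_
        rw [integral_const_mul]
        exact le_of_eq (by ring))

@[simp]
theorem regDist_apply {g : ℝ → ℂ} (hg : IsTempered g) (χ : 𝓢(ℝ, ℂ)) :
    regDist g hg χ = ∫ x, χ x * g x := rfl

theorem isFunction_regDist {g : ℝ → ℂ} (hg : IsTempered g) : IsFunction (regDist g hg) g :=
  ⟨hg.locallyIntegrable, fun χ _ => regDist_apply hg χ⟩

/-! ### Cutting off Schwartz functions -/

/-- A smooth bump function equal to `1` on `[-1, 1]` and supported in `[-2, 2]`. -/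
def bump : ContDiffBump (0 : ℝ) := ⟨1, 2, one_pos, one_lt_two⟩

theorem contDiff_bump_comp (c : ℝ) : ContDiff ℝ ∞ (fun x : ℝ => ((bump (c * x) : ℝ) : ℂ)) :=
  Complex.ofRealCLM.contDiff.comp (bump.contDiff.comp (contDiff_const.mul contDiff_id))

theorem hasCompactSupport_bump_comp {c : ℝ} (hc : c ≠ 0) :
    HasCompactSupport (fun x : ℝ => ((bump (c * x) : ℝ) : ℂ)) :=
  (bump.hasCompactSupport.comp_homeomorph (Homeomorph.mulLeft₀ c hc)).comp_left
    (g := fun r : ℝ => (r : ℂ)) Complex.ofReal_zero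

theorem natCast_inv_ne_zero (n : ℕ) : ((n : ℝ) + 1)⁻¹ ≠ 0 := by positivity

/-- The cutoff function `x ↦ bump (x / (n + 1))`. -/
def cutoff (n : ℕ) : 𝓢(ℝ, ℂ) :=
  (hasCompactSupport_bump_comp (natCast_inv_ne_zero n)).toSchwartzMap (contDiff_bump_comp _)

theorem cutoff_apply (n : ℕ) (x : ℝ) :
    cutoff n x = ((bump (((n : ℝ) + 1)⁻¹ * x) : ℝ) : ℂ) := rfl

theorem hasCompactSupport_cutoff (n : ℕ) : HasCompactSupport (cutoff n) :=
  hasCompactSupport_bump_comp (natCast_inv_ne_zero n)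

theorem cutoff_eq_one {n : ℕ} {x : ℝ} (hx : |x| ≤ n + 1) : cutoff n x = 1 := by
  rw [cutoff_apply, bump.one_of_mem_closedBall]
  · simp
  · rw [mem_closedBall_zero_iff, Real.norm_eq_abs, abs_mul, abs_inv,
      abs_of_pos (by positivity : (0 : ℝ) < n + 1)]
    rw [inv_mul_le_iff₀ (by positivity)]
    simpa [bump] using hx

theorem norm_cutoff_le_one (n : ℕ) (x : ℝ) : ‖cutoff n x‖ ≤ 1 := by
  rw [cutoff_apply, Complex.norm_real, Real.norm_of_nonneg bump.nonneg]
  exact bump.le_one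

theorem iteratedDeriv_cutoff (n i : ℕ) (x : ℝ) :
    iteratedDeriv i (cutoff n) x =
      (((n : ℝ) + 1)⁻¹) ^ i • iteratedDeriv i (cutoff 0) (((n : ℝ) + 1)⁻¹ * x) := by
  have h := congrFun (iteratedDeriv_comp_const_smul (n := i) ((cutoff 0).smooth i)
    (((n : ℝ) + 1)⁻¹)) x
  rw [← h]
  congr 1
  ext y
  simp [cutoff_apply]

/-- The product of a Schwartz function with the cutoff function `cutoff n`. -/
def truncate (n : ℕ) (χ : 𝓢(ℝ, ℂ)) : 𝓢(ℝ, ℂ) := smulLeftCLM ℂ (cutoff n) χ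

theorem truncate_apply (n : ℕ) (χ : 𝓢(ℝ, ℂ)) (x : ℝ) : truncate n χ x = cutoff n x * χ x := by
  simp [truncate, smulLeftCLM_apply_apply (cutoff n).hasTemperateGrowth]

theorem hasCompactSupport_truncate (n : ℕ) (χ : 𝓢(ℝ, ℂ)) : HasCompactSupport (truncate n χ) := by
  have : (truncate n χ : ℝ → ℂ) = fun x => cutoff n x * χ x := funext (truncate_apply n χ)
  rw [this]
  exact (hasCompactSupport_cutoff n).mul_right

theorem seminorm_cutoff_le (k l n : ℕ) :
    SchwartzMap.seminorm ℂ k l (cutoff n) ≤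
      ((n : ℝ) + 1) ^ k * SchwartzMap.seminorm ℂ k l (cutoff 0) := by
  refine seminorm_le_bound' ℂ k l _ (by positivity) fun x => ?_
  have h := le_seminorm' ℂ k l (cutoff 0) (((n : ℝ) + 1)⁻¹ * x)
  have hn : (0 : ℝ) < n + 1 := by positivity
  rw [iteratedDeriv_cutoff, norm_smul, norm_pow, norm_inv, Real.norm_of_nonneg hn.le]
  rw [abs_mul, abs_inv, abs_of_pos hn, mul_pow] at h
  have h1 : (((n : ℝ) + 1)⁻¹) ^ l ≤ 1 :=
    pow_le_one₀ (by positivity) (inv_le_one_of_one_le₀ (by linarith [n.cast_nonneg (α := ℝ)]))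
  calc |x| ^ k * ((((n : ℝ) + 1)⁻¹) ^ l * ‖iteratedDeriv l (cutoff 0) (((n : ℝ) + 1)⁻¹ * x)‖)
      ≤ |x| ^ k * (1 * ‖iteratedDeriv l (cutoff 0) (((n : ℝ) + 1)⁻¹ * x)‖) := by gcongr
    _ = ((n : ℝ) + 1) ^ k * ((((n : ℝ) + 1)⁻¹) ^ k * |x| ^ k *
          ‖iteratedDeriv l (cutoff 0) (((n : ℝ) + 1)⁻¹ * x)‖) := by
        rw [inv_pow]; field_simp
    _ ≤ _ := by gcongr

theorem norm_iteratedFDeriv_cutoff_sub_one_le (i n : ℕ) (x : ℝ) :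
    ‖iteratedFDeriv ℝ i (fun y => cutoff n y - 1) x‖ ≤
      (2 + SchwartzMap.seminorm ℂ 0 i (cutoff 0)) * ((1 + |x|) * ((n : ℝ) + 1)⁻¹) := by
  have hn : (0 : ℝ) < n + 1 := by positivity
  have hs : 0 ≤ SchwartzMap.seminorm ℂ 0 i (cutoff 0) := apply_nonneg _ _
  rw [norm_iteratedFDeriv_eq_norm_iteratedDeriv]
  rcases Nat.eq_zero_or_pos i with rfl | hi
  · rw [iteratedDeriv_zero]
    by_cases hx : |x| ≤ n + 1
    · rw [cutoff_eq_one hx]; simp; positivity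
    · have h1 : ‖cutoff n x - 1‖ ≤ 2 := by
        refine (norm_sub_le _ _).trans ?_
        have := norm_cutoff_le_one n x
        simp only [norm_one]; linarith
      have h2 : 1 ≤ (1 + |x|) * ((n : ℝ) + 1)⁻¹ := by
        rw [← div_eq_mul_inv, one_le_div hn]; linarith
      nlinarith
  · have h0 : iteratedDeriv i (fun y => cutoff n y - 1) x = iteratedDeriv i (cutoff n) x := by
      obtain ⟨j, rfl⟩ : ∃ j, i = j + 1 := ⟨i - 1, by omega⟩
      have hd : deriv (fun y => cutoff n y - 1) = deriv (cutoff n) :=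
        funext fun y => by simp only [deriv_sub_const]
      rw [iteratedDeriv_succ', iteratedDeriv_succ', hd]
    have h := le_seminorm' ℂ 0 i (cutoff 0) (((n : ℝ) + 1)⁻¹ * x)
    rw [pow_zero, one_mul] at h
    rw [h0, iteratedDeriv_cutoff, norm_smul, norm_pow, norm_inv, Real.norm_of_nonneg hn.le]
    have h1 : (((n : ℝ) + 1)⁻¹) ^ i ≤ ((n : ℝ) + 1)⁻¹ :=
      pow_le_of_le_one (by positivity)
        (inv_le_one_of_one_le₀ (by linarith [n.cast_nonneg (α := ℝ)])) hi.ne'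
    calc _ ≤ ((n : ℝ) + 1)⁻¹ * SchwartzMap.seminorm ℂ 0 i (cutoff 0) := by gcongr
      _ ≤ (1 + |x|) * (((n : ℝ) + 1)⁻¹ * SchwartzMap.seminorm ℂ 0 i (cutoff 0)) := by
          refine le_mul_of_one_le_left (by positivity) (by linarith [abs_nonneg x])
      _ ≤ _ := by
          have : 0 ≤ (1 + |x|) * ((n : ℝ) + 1)⁻¹ := by positivity
          nlinarith

/-- Truncated Schwartz functions converge in the topology of the Schwartz space. -/
theorem tendsto_truncate (χ : 𝓢(ℝ, ℂ)) : Tendsto (fun n => truncate n χ) atTop (𝓝 χ) := by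
  rw [(schwartz_withSeminorms ℂ ℝ ℂ).tendsto_nhds]
  rintro ⟨k, l⟩ ε hε
  obtain ⟨D, hD0, hD⟩ : ∃ D : ℝ, 0 ≤ D ∧ ∀ n : ℕ,
      SchwartzMap.seminorm ℂ k l (truncate n χ - χ) ≤ D * ((n : ℝ) + 1)⁻¹ := by
    refine ⟨∑ i ∈ Finset.range (l + 1), (l.choose i : ℝ) *
      (2 + SchwartzMap.seminorm ℂ 0 i (cutoff 0)) *
        (SchwartzMap.seminorm ℂ k (l - i) χ + SchwartzMap.seminorm ℂ (k + 1) (l - i) χ),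
        by positivity, fun n => ?_⟩
    refine seminorm_le_bound ℂ k l _ (by positivity) fun x => ?_
    have he : ((truncate n χ - χ : 𝓢(ℝ, ℂ)) : ℝ → ℂ) = fun y => (cutoff n y - 1) * χ y := by
      ext y
      simp [truncate_apply, sub_mul]
    rw [he]
    have hL := norm_iteratedFDeriv_mul_le (𝕜 := ℝ) (f := fun y => cutoff n y - 1) (g := χ)
      (N := ∞) (((cutoff n).smooth ⊤).sub contDiff_const) (χ.smooth ⊤) x
      (n := l) (by exact_mod_cast le_top)
    rw [Finset.sum_mul]
    refine (mul_le_mul_of_nonneg_left hL (by positivity)).trans ?_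
    rw [Finset.mul_sum]
    refine Finset.sum_le_sum fun i _ => ?_
    have h1 := norm_iteratedFDeriv_cutoff_sub_one_le i n x
    have h2 := le_seminorm ℂ k (l - i) χ x
    have h3 := le_seminorm ℂ (k + 1) (l - i) χ x
    rw [Real.norm_eq_abs] at h2 h3 ⊢
    have hs : 0 ≤ SchwartzMap.seminorm ℂ 0 i (cutoff 0) := apply_nonneg _ _
    calc |x| ^ k * ((l.choose i : ℝ) * ‖iteratedFDeriv ℝ i (fun y => cutoff n y - 1) x‖ *
          ‖iteratedFDeriv ℝ (l - i) χ x‖)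
        ≤ |x| ^ k * ((l.choose i : ℝ) * ((2 + SchwartzMap.seminorm ℂ 0 i (cutoff 0)) *
          ((1 + |x|) * ((n : ℝ) + 1)⁻¹)) * ‖iteratedFDeriv ℝ (l - i) χ x‖) := by gcongr
      _ = (l.choose i : ℝ) * (2 + SchwartzMap.seminorm ℂ 0 i (cutoff 0)) *
          (|x| ^ k * ‖iteratedFDeriv ℝ (l - i) χ x‖ +
            |x| ^ (k + 1) * ‖iteratedFDeriv ℝ (l - i) χ x‖) * ((n : ℝ) + 1)⁻¹ := by ring
      _ ≤ _ := by gcongr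
  have ht : Tendsto (fun n : ℕ => D * ((n : ℝ) + 1)⁻¹) atTop (𝓝 0) := by
    have := tendsto_one_div_add_atTop_nhds_zero_nat (𝕜 := ℝ)
    simpa using this.const_mul D
  filter_upwards [ht.eventually (gt_mem_nhds hε)] with n hn
  exact (hD n).trans_lt hn

/-- Test functions of compact support determine a tempered distribution, by density. -/
theorem ext_of_hasCompactSupport {S T : 𝓢'(ℝ, ℂ)}
    (h : ∀ χ : 𝓢(ℝ, ℂ), HasCompactSupport χ → S χ = T χ) : S = T := by
  ext χ
  refine tendsto_nhds_unique (f := fun n => S (truncate n χ)) (l := atTop) ?_ ?_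
  · exact (S.continuous.tendsto χ).comp (tendsto_truncate χ)
  · simp_rw [fun n => h _ (hasCompactSupport_truncate n χ)]
    exact (T.continuous.tendsto χ).comp (tendsto_truncate χ)

theorem IsFunction.eq_regDist {T : 𝓢'(ℝ, ℂ)} {g : ℝ → ℂ} (h : IsFunction T g)
    (hg : IsTempered g) : T = regDist g hg :=
  ext_of_hasCompactSupport fun χ hχ => (h.2 χ hχ).trans (regDist_apply hg χ).symm

theorem IsFunction.congr {T : 𝓢'(ℝ, ℂ)} {g g' : ℝ → ℂ} (h : IsFunction T g)
    (hg : g =ᵐ[volume] g') : IsFunction T g' := by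
  refine ⟨h.1.congr hg, fun χ hχ => (h.2 χ hχ).trans (integral_congr_ae ?_)⟩
  filter_upwards [hg] with x hx
  rw [hx]

theorem IsFunction.ae_eq {T : 𝓢'(ℝ, ℂ)} {g g' : ℝ → ℂ} (h : IsFunction T g)
    (h' : IsFunction T g') : g =ᵐ[volume] g' := by
  refine ae_eq_of_integral_contDiff_smul_eq h.1 h'.1 fun b hb hbc => ?_
  have hc : HasCompactSupport (fun x => (b x : ℂ)) :=
    hbc.comp_left (g := fun r : ℝ => (r : ℂ)) Complex.ofReal_zero
  have hs : ContDiff ℝ ∞ (fun x => (b x : ℂ)) := Complex.ofRealCLM.contDiff.comp hb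
  have h1 := h.2 (hc.toSchwartzMap hs) hc
  have h2 := h'.2 (hc.toSchwartzMap hs) hc
  simpa [Complex.real_smul] using h1.symm.trans h2

theorem integrable_mul_of_hasCompactSupport {g : ℝ → ℂ} (hg : LocallyIntegrable g)
    {χ : ℝ → ℂ} (hc : Continuous χ) (hχ : HasCompactSupport χ) :
    Integrable (fun x => χ x * g x) :=
  hg.integrable_smul_left_of_hasCompactSupport hc hχ

/-! ### Convolutions on the Fourier side -/

theorem integral_fourier_mul_eq_of_integrable {f g : ℝ → ℂ} (hf : Integrable f)
    (hg : Integrable g) : ∫ ξ, 𝓕 f ξ * g ξ = ∫ x, f x * 𝓕 g x := by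
  simpa using! VectorFourier.integral_bilin_fourierIntegral_eq_flip (ContinuousLinearMap.mul ℂ ℂ)
    (L := innerₗ ℝ) Real.continuous_fourierChar continuous_inner hf hg

theorem integral_fourierInv_mul_eq_of_integrable {f g : ℝ → ℂ} (hf : Integrable f)
    (hg : Integrable g) : ∫ ξ, 𝓕⁻ f ξ * g ξ = ∫ x, f x * 𝓕⁻ g x := by
  rw [Real.fourierInv_eq_fourier_comp_neg g, ← integral_fourier_mul_eq_of_integrable hf hg.comp_neg,
    ← integral_neg_eq_self]
  simp only [Real.fourierInv_eq_fourier_neg, neg_neg]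

theorem fourierInv_reflectAt (f : 𝓢(ℝ, ℂ)) (x ξ : ℝ) :
    𝓕⁻ (reflectAt f x) ξ = Complex.exp (↑(2 * Real.pi * (ξ * x)) * Complex.I) * 𝓕 f ξ := by
  rw [fourierInv_coe, fourier_coe, Real.fourierInv_eq', Real.fourier_eq', ← integral_const_mul,
    ← integral_sub_left_eq_self _ volume x]
  congr 1
  ext y
  simp only [reflectAt_apply, sub_sub_cancel, smul_eq_mul, RCLike.inner_apply,
    conj_trivial, ← mul_assoc, ← Complex.exp_add]
  congr 2
  push_cast
  ring

theorem conv_eq_fourier_apply (T : 𝓢'(ℝ, ℂ)) (f : 𝓢(ℝ, ℂ)) (x : ℝ) :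
    conv T f x = (𝓕 T) (𝓕⁻ (reflectAt f x)) := by
  rw [TemperedDistribution.fourier_apply, FourierTransform.fourier_fourierInv_eq, conv]

theorem conv_eq_fourierInv {T : 𝓢'(ℝ, ℂ)} {m : ℝ → ℂ} {f : 𝓢(ℝ, ℂ)} {x : ℝ}
    (h : (𝓕 T) (𝓕⁻ (reflectAt f x)) = ∫ ξ, 𝓕⁻ (reflectAt f x) ξ * m ξ) :
    conv T f x = 𝓕⁻ (fun ξ => 𝓕 f ξ * m ξ) x := by
  rw [conv_eq_fourier_apply, h, Real.fourierInv_eq']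
  congr 1
  ext ξ
  rw [fourierInv_reflectAt]
  simp only [smul_eq_mul, RCLike.inner_apply, conj_trivial, mul_comm x ξ]
  ring

theorem conv_eq_of_isTempered {T : 𝓢'(ℝ, ℂ)} {m : ℝ → ℂ} (hm : IsTempered m)
    (h : 𝓕 T = regDist m hm) (f : 𝓢(ℝ, ℂ)) (x : ℝ) :
    conv T f x = 𝓕⁻ (fun ξ => 𝓕 f ξ * m ξ) x :=
  conv_eq_fourierInv (by rw [h, regDist_apply])

theorem conv_eq_of_hasCompactSupport {T : 𝓢'(ℝ, ℂ)} {m : ℝ → ℂ} (h : IsFunction (𝓕 T) m)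
    {f : 𝓢(ℝ, ℂ)} (hf : HasCompactSupport ((𝓕 f : 𝓢(ℝ, ℂ)) : ℝ → ℂ)) (x : ℝ) :
    conv T f x = 𝓕⁻ (fun ξ => 𝓕 f ξ * m ξ) x := by
  refine conv_eq_fourierInv (h.2 _ ?_)
  have : ((𝓕⁻ (reflectAt f x) : 𝓢(ℝ, ℂ)) : ℝ → ℂ) = fun ξ =>
      Complex.exp (↑(2 * Real.pi * (ξ * x)) * Complex.I) * 𝓕 f ξ :=
    funext (fourierInv_reflectAt f x)
  rw [this]
  exact hf.mul_left

theorem fourierInv_conj (f : ℝ → ℂ) (ξ : ℝ) :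
    𝓕⁻ (fun x => (starRingEnd ℂ) (f x)) ξ = (starRingEnd ℂ) (𝓕 f ξ) := by
  rw [Real.fourierInv_eq', Real.fourier_eq', ← integral_conj]
  congr 1
  ext x
  simp only [smul_eq_mul, map_mul, ← Complex.exp_conj, Complex.conj_ofReal, Complex.conj_I]
  congr 2
  push_cast
  ring

theorem pair_conv_eq {T : 𝓢'(ℝ, ℂ)} {m : ℝ → ℂ} (h : IsFunction (𝓕 T) m)
    {f : 𝓢(ℝ, ℂ)} (hf : HasCompactSupport ((𝓕 f : 𝓢(ℝ, ℂ)) : ℝ → ℂ)) :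
    pair (conv T f) f = ∫ ξ, (‖𝓕 f ξ‖ ^ 2 : ℝ) * m ξ := by
  have hi : Integrable (fun ξ => 𝓕 f ξ * m ξ) :=
    integrable_mul_of_hasCompactSupport h.1 (𝓕 f).continuous hf
  have hc : Integrable (fun x => (starRingEnd ℂ) (f x)) := by
    simpa using (Complex.conjCLE.integrable_comp_iff (φ := f)).2 f.integrable
  simp only [pair, conv_eq_of_hasCompactSupport h hf]
  rw [integral_fourierInv_mul_eq_of_integrable hi hc]
  congr 1
  ext ξ
  rw [fourierInv_conj, ← fourier_coe]
  have := Complex.mul_conj (𝓕 f ξ)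
  rw [Complex.normSq_eq_norm_sq] at this
  rw [← this]
  ring

/-! ### Positivity and temperedness of the symbol -/

theorem integral_normSq_mul_nonneg {T : 𝓢'(ℝ, ℂ)} {m : ℝ → ℂ} (h : IsFunction (𝓕 T) m)
    (hpos : ∀ χ : 𝓢(ℝ, ℂ), 0 ≤ pair (conv T χ) χ) {ψ : 𝓢(ℝ, ℂ)} (hψ : HasCompactSupport ψ) :
    0 ≤ ∫ ξ, (‖ψ ξ‖ ^ 2 : ℝ) * m ξ := by
  have he : 𝓕 (𝓕⁻ ψ) = ψ := FourierTransform.fourier_fourierInv_eq ψ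
  have := hpos (𝓕⁻ ψ)
  rwa [pair_conv_eq h (by rwa [he]), he] at this

/-- A nonnegative smooth test function `g` is approximated by the squares `b² (g + ε)`, where `b`
is a cutoff function equal to `1` on the support of `g`. -/
theorem integral_mul_nonneg {T : 𝓢'(ℝ, ℂ)} {m : ℝ → ℂ} (h : IsFunction (𝓕 T) m)
    (hpos : ∀ χ : 𝓢(ℝ, ℂ), 0 ≤ pair (conv T χ) χ) {g : ℝ → ℝ} (hg : ContDiff ℝ ∞ g)
    (hgc : HasCompactSupport g) (hg0 : ∀ x, 0 ≤ g x) : 0 ≤ ∫ ξ, (g ξ : ℂ) * m ξ := by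
  obtain ⟨N, hN⟩ : ∃ N : ℕ, ∀ x, g x ≠ 0 → cutoff N x = 1 := by
    obtain ⟨R, hR⟩ := hgc.isCompact.isBounded.exists_norm_le
    obtain ⟨N, hN⟩ := exists_nat_ge R
    refine ⟨N, fun x hx => cutoff_eq_one ?_⟩
    have := hR x (subset_tsupport _ hx)
    rw [Real.norm_eq_abs] at this
    linarith
  have hc2 : HasCompactSupport (fun ξ => ((‖cutoff N ξ‖ ^ 2 : ℝ) : ℂ)) :=
    (hasCompactSupport_cutoff N).comp_left (g := fun z : ℂ => ((‖z‖ ^ 2 : ℝ) : ℂ)) (by simp)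
  have hcc : Continuous (fun ξ => ((‖cutoff N ξ‖ ^ 2 : ℝ) : ℂ)) :=
    Complex.continuous_ofReal.comp ((cutoff N).continuous.norm.pow 2)
  have hgi : Integrable (fun ξ => (g ξ : ℂ) * m ξ) :=
    integrable_mul_of_hasCompactSupport h.1 (Complex.continuous_ofReal.comp hg.continuous)
      (hgc.comp_left (g := fun r : ℝ => (r : ℂ)) Complex.ofReal_zero)
  have hci : Integrable (fun ξ => ((‖cutoff N ξ‖ ^ 2 : ℝ) : ℂ) * m ξ) :=
    integrable_mul_of_hasCompactSupport h.1 hcc hc2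
  have key : ∀ n : ℕ, 0 ≤ (∫ ξ, (g ξ : ℂ) * m ξ) +
      ((1 / ((n : ℝ) + 1) : ℝ) : ℂ) * ∫ ξ, ((‖cutoff N ξ‖ ^ 2 : ℝ) : ℂ) * m ξ := by
    intro n
    set ε : ℝ := 1 / ((n : ℝ) + 1) with hε
    have hε0 : 0 < ε := by positivity
    have hs : ContDiff ℝ ∞ (fun x => ((Real.sqrt (g x + ε) : ℝ) : ℂ)) :=
      Complex.ofRealCLM.contDiff.comp
        ((hg.add contDiff_const).sqrt fun x => by linarith [hg0 x, hε0] |> ne_of_gt)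
    have hψc : HasCompactSupport (fun x => cutoff N x * ((Real.sqrt (g x + ε) : ℝ) : ℂ)) :=
      (hasCompactSupport_cutoff N).mul_right
    have h1 := integral_normSq_mul_nonneg h hpos
      (ψ := hψc.toSchwartzMap (((cutoff N).smooth ⊤).mul hs)) hψc
    convert h1 using 1
    rw [← integral_const_mul, ← integral_add hgi (hci.const_mul _)]
    congr 1
    ext ξ
    have hsq : Real.sqrt (g ξ + ε) ^ 2 = g ξ + ε := Real.sq_sqrt (by linarith [hg0 ξ])
    change _ = ((‖cutoff N ξ * ((Real.sqrt (g ξ + ε) : ℝ) : ℂ)‖ ^ 2 : ℝ) : ℂ) * m ξ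
    simp only [norm_mul, mul_pow, Complex.norm_real, Real.norm_eq_abs, sq_abs, hsq]
    by_cases hx : g ξ = 0
    · rw [hx]; push_cast; ring
    · rw [hN ξ hx]; push_cast; simp; ring
  have ht := tendsto_one_div_add_atTop_nhds_zero_nat (𝕜 := ℝ)
  have ht' := (Complex.continuous_ofReal.tendsto 0).comp ht
  have := (ht'.mul_const (∫ ξ, ((‖cutoff N ξ‖ ^ 2 : ℝ) : ℂ) * m ξ)).const_add
    (∫ ξ, (g ξ : ℂ) * m ξ)
  refine ge_of_tendsto' (x := atTop) ?_ key
  simpa using this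

/-- The Fourier transform of a positive convolution kernel is nonnegative: its averages against
bump functions are, and they converge to it almost everywhere by Lebesgue differentiation. -/
theorem symbol_nonneg {T : 𝓢'(ℝ, ℂ)} {m : ℝ → ℂ} (h : IsFunction (𝓕 T) m)
    (hpos : ∀ χ : 𝓢(ℝ, ℂ), 0 ≤ pair (conv T χ) χ) : ∀ᵐ ξ, 0 ≤ m ξ := by
  let b : ℕ → ContDiffBump (0 : ℝ) := fun n =>
    ⟨1 / ((n : ℝ) + 1), 2 * (1 / ((n : ℝ) + 1)), by positivity, by
      have : 0 < 1 / ((n : ℝ) + 1) := by positivity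
      linarith⟩
  have hb : Tendsto (fun n => (b n).rOut) atTop (𝓝 0) := by
    simpa [b] using (tendsto_one_div_add_atTop_nhds_zero_nat (𝕜 := ℝ)).const_mul 2
  filter_upwards [ContDiffBump.ae_convolution_tendsto_right_of_locallyIntegrable (K := 2) hb
    (Eventually.of_forall fun n => le_rfl) h.1] with x hx
  refine ge_of_tendsto' hx fun n => ?_
  rw [convolution_eq_swap]
  have := integral_mul_nonneg h hpos (g := fun y => (b n).normed volume (x - y))
    ((b n).contDiff_normed.comp (contDiff_const.sub contDiff_id))
    ((b n).hasCompactSupport_normed.comp_homeomorph (Homeomorph.subLeft x))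
    (fun y => (b n).nonneg_normed _)
  simpa [ContinuousLinearMap.lsmul_apply, Complex.real_smul] using this

/-- By continuity in finitely many Schwartz seminorms, which grow polynomially along the cutoff
functions. -/
theorem exists_norm_apply_cutoff_le (S : 𝓢'(ℝ, ℂ)) :
    ∃ (C : ℝ) (N : ℕ), ∀ n : ℕ, ‖S (cutoff n)‖ ≤ C * ((n : ℝ) + 1) ^ N := by
  obtain ⟨s, C, -, hC⟩ := Seminorm.bound_of_continuous (schwartz_withSeminorms ℂ ℝ ℂ)
    ((normSeminorm ℂ ℂ).comp (S : 𝓢(ℝ, ℂ) →ₗ[ℂ] ℂ)) (continuous_norm.comp S.continuous)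
  refine ⟨C * ∑ i ∈ s, SchwartzMap.seminorm ℂ i.1 i.2 (cutoff 0), s.sup Prod.fst, fun n => ?_⟩
  have h1 : ‖S (cutoff n)‖ ≤ C * (s.sup (schwartzSeminormFamily ℂ ℝ ℂ)) (cutoff n) := hC _
  refine h1.trans ?_
  rw [mul_assoc]
  gcongr
  refine Seminorm.finset_sup_apply_le (by positivity) fun i hi => ?_
  refine (seminorm_cutoff_le i.1 i.2 n).trans ?_
  rw [mul_comm]
  gcongr
  · exact Finset.single_le_sum (f := fun i : ℕ × ℕ => SchwartzMap.seminorm ℂ i.1 i.2 (cutoff 0))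
      (fun i _ => apply_nonneg _ _) hi
  · linarith [n.cast_nonneg (α := ℝ)]
  · exact Finset.le_sup (f := Prod.fst) hi

/-- A nonnegative locally integrable function that is a tempered distribution is tempered in the
mean: testing against cutoff functions bounds its integral over `[-n, n]` by a power of `n`. -/
theorem isTempered_of_nonneg {S : 𝓢'(ℝ, ℂ)} {m : ℝ → ℂ} (h : IsFunction S m)
    (hm : ∀ᵐ ξ, 0 ≤ m ξ) : IsTempered m := by
  obtain ⟨C, N, hCN⟩ := exists_norm_apply_cutoff_le S
  -- The functions `F n` have summable `L¹` norms, and `F n` dominates the weighted `m` at the points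
  -- with `n = ⌈|x|⌉`, so their sum dominates it everywhere.
  let F : ℕ → ℝ → ℂ := fun n x => ((2 ^ (N + 2) * (((n : ℝ) + 1) ^ (N + 2))⁻¹ : ℝ) : ℂ) *
    (cutoff n x * m x)
  have hi : ∀ n, Integrable (fun x => cutoff n x * m x) := fun n =>
    integrable_mul_of_hasCompactSupport h.1 (cutoff n).continuous (hasCompactSupport_cutoff n)
  have hFi : ∀ n, Integrable (F n) := fun n => (hi n).const_mul _
  have hnorm : ∀ n, ∫ x, ‖cutoff n x * m x‖ ≤ C * ((n : ℝ) + 1) ^ N := by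
    intro n
    refine le_trans ?_ (hCN n)
    rw [h.2 _ (hasCompactSupport_cutoff n)]
    have : ∫ x, cutoff n x * m x = ((∫ x, ‖cutoff n x * m x‖ : ℝ) : ℂ) := by
      rw [← integral_complex_ofReal]
      refine integral_congr_ae ?_
      filter_upwards [hm] with x hx
      have h0 : 0 ≤ cutoff n x * m x := by
        refine mul_nonneg ?_ hx
        rw [cutoff_apply]
        exact Complex.zero_le_real.2 bump.nonneg
      exact Complex.eq_coe_norm_of_nonneg h0
    rw [this, Complex.norm_real]
    exact le_abs_self _
  have hFnorm : ∀ n, ∫ x, ‖F n x‖ ≤ 2 ^ (N + 2) * C * (1 / ((n : ℝ) + 1) ^ 2) := by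
    intro n
    have hn : (0 : ℝ) < n + 1 := by positivity
    have h1 : ∀ x, ‖F n x‖ = (2 ^ (N + 2) * (((n : ℝ) + 1) ^ (N + 2))⁻¹) *
        ‖cutoff n x * m x‖ := by
      intro x
      rw [norm_mul (_ : ℂ), Complex.norm_real, Real.norm_of_nonneg (by positivity)]
    simp_rw [h1]
    rw [integral_const_mul]
    calc _ ≤ (2 ^ (N + 2) * (((n : ℝ) + 1) ^ (N + 2))⁻¹) * (C * ((n : ℝ) + 1) ^ N) := by
          gcongr; exact hnorm n
      _ = _ := by rw [pow_add ((n : ℝ) + 1)]; field_simp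
  have hsum : Summable (fun n => ∫ x, ‖F n x‖) := by
    refine Summable.of_nonneg_of_le (fun n => integral_nonneg fun x => norm_nonneg _) hFnorm
      (Summable.mul_left _ ?_)
    exact_mod_cast (summable_nat_add_iff 1).2 (Real.summable_one_div_nat_pow.2 one_lt_two)
  refine ⟨N + 2, ?_, ?_⟩
  · exact AEStronglyMeasurable.smul
      (by fun_prop : Measurable fun x : ℝ => ((1 + |x|) ^ (N + 2))⁻¹).aestronglyMeasurable
      h.1.aestronglyMeasurable
  · rw [hasFiniteIntegral_iff_enorm]
    calc ∫⁻ x, ‖((1 + |x|) ^ (N + 2))⁻¹ • m x‖ₑ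
        ≤ ∫⁻ x, ∑' n, ‖F n x‖ₑ := by
          refine lintegral_mono fun x => ?_
          refine le_trans ?_ (ENNReal.le_tsum ⌈|x|⌉₊)
          rw [enorm_le_iff_norm_le]
          have h1 := Nat.le_ceil |x|
          have h2 := Nat.ceil_lt_add_one (abs_nonneg x)
          set k := ⌈|x|⌉₊
          have h3 : (k : ℝ) + 1 ≤ 2 * (1 + |x|) := by linarith [abs_nonneg x]
          have hk : (0 : ℝ) < k + 1 := by positivity
          rw [norm_smul, norm_mul, Complex.norm_real, Real.norm_of_nonneg (by positivity),
            Real.norm_of_nonneg (by positivity), cutoff_eq_one (by linarith), one_mul]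
          gcongr
          rw [← div_eq_mul_inv, inv_le_comm₀ (by positivity) (by positivity), inv_div,
            div_le_iff₀ (by positivity), ← mul_pow]
          gcongr
          linarith
      _ = ∑' n, ∫⁻ x, ‖F n x‖ₑ := lintegral_tsum fun n => (hFi n).aestronglyMeasurable.enorm
      _ = ∑' n, ENNReal.ofReal (∫ x, ‖F n x‖) := by
          simp_rw [fun n => ofReal_integral_norm_eq_lintegral_enorm (hFi n)]
      _ < ⊤ := hsum.tsum_ofReal_lt_top

/-! ### The propagators and existence of solutions -/

/-- The frequency `√φ`. -/
def freq (φ : ℝ → ℂ) (ξ : ℝ) : ℝ := Real.sqrt (φ ξ).re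

/-- The symbol `cos (t √φ)` of the propagator of the initial position. -/
def cosSymbol (φ : ℝ → ℂ) (t ξ : ℝ) : ℂ := (Real.cos (t * freq φ ξ) : ℝ)

/-- The symbol `sin (t √φ) / √φ` of the propagator of the initial velocity; the form with the
`sinc` function gives the right value `t` where `φ` vanishes. -/
def sinSymbol (φ : ℝ → ℂ) (t ξ : ℝ) : ℂ := (t * Real.sinc (t * freq φ ξ) : ℝ)

theorem freq_nonneg (φ : ℝ → ℂ) (ξ : ℝ) : 0 ≤ freq φ ξ := Real.sqrt_nonneg _

theorem ofReal_freq_sq {φ : ℝ → ℂ} {ξ : ℝ} (h : 0 ≤ φ ξ) : ((freq φ ξ : ℝ) : ℂ) ^ 2 = φ ξ := by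
  have h1 := Complex.nonneg_iff.1 h
  rw [freq, ← Complex.ofReal_pow, Real.sq_sqrt h1.1]
  exact Complex.ext (by simp) (by simpa using h1.2)

theorem freq_le {φ : ℝ → ℂ} {ξ : ℝ} (h : 0 ≤ φ ξ) : freq φ ξ ≤ 1 + ‖φ ξ‖ := by
  have h1 := congrArg norm (ofReal_freq_sq h)
  rw [norm_pow, Complex.norm_real, Real.norm_of_nonneg (freq_nonneg _ _)] at h1
  nlinarith [sq_nonneg (freq φ ξ - 1), freq_nonneg φ ξ]

theorem aestronglyMeasurable_freq {φ : ℝ → ℂ} (hφ : AEStronglyMeasurable φ) :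
    AEStronglyMeasurable (freq φ) :=
  (Real.continuous_sqrt.comp Complex.continuous_re).comp_aestronglyMeasurable hφ

theorem aestronglyMeasurable_cosSymbol {φ : ℝ → ℂ} (hφ : AEStronglyMeasurable φ) (t : ℝ) :
    AEStronglyMeasurable (cosSymbol φ t) :=
  (by fun_prop : Continuous fun r : ℝ => ((Real.cos (t * r) : ℝ) : ℂ)).comp_aestronglyMeasurable
    (aestronglyMeasurable_freq hφ)

theorem aestronglyMeasurable_sinSymbol {φ : ℝ → ℂ} (hφ : AEStronglyMeasurable φ) (t : ℝ) :
    AEStronglyMeasurable (sinSymbol φ t) := by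
  have : Continuous fun r : ℝ => ((t * Real.sinc (t * r) : ℝ) : ℂ) :=
    Complex.continuous_ofReal.comp
      (continuous_const.mul (Real.continuous_sinc.comp (continuous_const.mul continuous_id)))
  exact this.comp_aestronglyMeasurable (aestronglyMeasurable_freq hφ)

theorem norm_cosSymbol_le (φ : ℝ → ℂ) (t ξ : ℝ) : ‖cosSymbol φ t ξ‖ ≤ 1 := by
  rw [cosSymbol, Complex.norm_real]
  exact Real.abs_cos_le_one _

theorem norm_sinSymbol_le (φ : ℝ → ℂ) (t ξ : ℝ) : ‖sinSymbol φ t ξ‖ ≤ |t| := by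
  rw [sinSymbol, Complex.norm_real, norm_mul, Real.norm_eq_abs, Real.norm_eq_abs]
  exact mul_le_of_le_one_right (abs_nonneg _) (Real.abs_sinc_le_one _)

theorem sinSymbol_mul_freq (φ : ℝ → ℂ) (t ξ : ℝ) :
    sinSymbol φ t ξ * freq φ ξ = (Real.sin (t * freq φ ξ) : ℝ) := by
  rw [sinSymbol]
  norm_cast
  by_cases h : t * freq φ ξ = 0
  · rw [h, Real.sin_zero, Real.sinc_zero]; linarith
  · rw [Real.sinc_of_ne_zero h]
    have h1 : t ≠ 0 := left_ne_zero_of_mul h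
    have h2 : freq φ ξ ≠ 0 := right_ne_zero_of_mul h
    field_simp

theorem isTempered_cosSymbol {φ : ℝ → ℂ} (hφ : AEStronglyMeasurable φ) (t : ℝ) :
    IsTempered (cosSymbol φ t) :=
  isTempered_of_norm_le (aestronglyMeasurable_cosSymbol hφ t)
    (Eventually.of_forall (norm_cosSymbol_le φ t))

theorem isTempered_sinSymbol {φ : ℝ → ℂ} (hφ : AEStronglyMeasurable φ) (t : ℝ) :
    IsTempered (sinSymbol φ t) :=
  isTempered_of_norm_le (aestronglyMeasurable_sinSymbol hφ t)
    (Eventually.of_forall (norm_sinSymbol_le φ t))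

/-- The symbol of `∂ₜ` of the propagator of the initial position. -/
def cosSymbolDeriv (φ : ℝ → ℂ) (t ξ : ℝ) : ℂ := -(sinSymbol φ t ξ * freq φ ξ * freq φ ξ)

theorem hasDerivAt_cosSymbol (φ : ℝ → ℂ) (t ξ : ℝ) :
    HasDerivAt (fun s => cosSymbol φ s ξ) (cosSymbolDeriv φ t ξ) t := by
  have h := (((hasDerivAt_id t).mul_const (freq φ ξ)).cos).ofReal_comp
  refine h.congr_deriv ?_
  rw [cosSymbolDeriv, sinSymbol_mul_freq]
  simp

theorem hasDerivAt_sinSymbol (φ : ℝ → ℂ) (t ξ : ℝ) :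
    HasDerivAt (fun s => sinSymbol φ s ξ) (cosSymbol φ t ξ) t := by
  by_cases hr : freq φ ξ = 0
  · have h : (fun s => sinSymbol φ s ξ) = fun s : ℝ => ((id s : ℝ) : ℂ) := by
      ext s
      simp [sinSymbol, hr]
    rw [h]
    refine (hasDerivAt_id t).ofReal_comp.congr_deriv ?_
    simp [cosSymbol, hr]
  · have hr' : ((freq φ ξ : ℝ) : ℂ) ≠ 0 := by exact_mod_cast hr
    have h : (fun s => sinSymbol φ s ξ) =
        fun s : ℝ => ((Real.sin (id s * freq φ ξ) : ℝ) : ℂ) / freq φ ξ := by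
      ext s
      rw [eq_div_iff hr', sinSymbol_mul_freq]
      rfl
    rw [h]
    refine ((((hasDerivAt_id t).mul_const (freq φ ξ)).sin).ofReal_comp.div_const _).congr_deriv ?_
    rw [div_eq_iff hr', cosSymbol]
    simp

theorem norm_cosSymbolDeriv_le {φ : ℝ → ℂ} {ξ : ℝ} (h : 0 ≤ φ ξ) (t : ℝ) :
    ‖cosSymbolDeriv φ t ξ‖ ≤ 1 + ‖φ ξ‖ := by
  rw [cosSymbolDeriv, norm_neg, norm_mul, sinSymbol_mul_freq, Complex.norm_real, Complex.norm_real,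
    Real.norm_of_nonneg (freq_nonneg _ _)]
  refine le_trans ?_ (freq_le h)
  exact mul_le_of_le_one_left (freq_nonneg _ _) (Real.abs_sin_le_one _)

theorem hasDerivAt_cosSymbolDeriv {φ : ℝ → ℂ} {ξ : ℝ} (h : 0 ≤ φ ξ) (t : ℝ) :
    HasDerivAt (fun s => cosSymbolDeriv φ s ξ) (-(φ ξ * cosSymbol φ t ξ)) t := by
  refine (((hasDerivAt_sinSymbol φ t ξ).mul_const _).mul_const _).neg.congr_deriv ?_
  rw [← ofReal_freq_sq h]
  ring

theorem cosSymbolDeriv_eq {φ : ℝ → ℂ} {ξ : ℝ} (h : 0 ≤ φ ξ) (t : ℝ) :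
    cosSymbolDeriv φ t ξ = -(φ ξ * sinSymbol φ t ξ) := by
  rw [cosSymbolDeriv, ← ofReal_freq_sq h]
  ring

theorem isTempered_of_norm_le_symbol {φ a : ℝ → ℂ} (hφ : IsTempered φ)
    (ha : AEStronglyMeasurable a) (c : ℝ) (h : ∀ᵐ ξ, ‖a ξ‖ ≤ c * (1 + ‖φ ξ‖)) :
    IsTempered a := by
  have h1 : IsTempered (fun ξ => ((c : ℂ) * (1 + (‖φ ξ‖ : ℂ)))) := by
    have h2 : IsTempered (fun _ : ℝ => (1 : ℂ)) :=
      isTempered_of_norm_le aestronglyMeasurable_const (B := 1) (by simp)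
    have h3 : IsTempered (fun ξ => (‖φ ξ‖ : ℂ)) := by
      obtain ⟨k, hk⟩ := hφ
      refine ⟨k, hk.norm.ofReal.congr (Eventually.of_forall fun ξ => ?_)⟩
      beta_reduce
      rw [norm_smul, norm_inv, Real.norm_of_nonneg (by positivity), Complex.real_smul]
      exact Complex.ofReal_mul _ _
    exact (h2.add h3).mul_of_norm_le (b := fun _ => (c : ℂ)) aestronglyMeasurable_const
      (B := ‖(c : ℂ)‖) (by simp)
  obtain ⟨k, hk⟩ := h1
  refine ⟨k, hk.mono ?_ ?_⟩
  · exact AEStronglyMeasurable.smul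
      (by fun_prop : Measurable fun x : ℝ => ((1 + |x|) ^ k)⁻¹).aestronglyMeasurable ha
  · filter_upwards [h] with ξ hξ
    rw [norm_smul, norm_smul]
    refine mul_le_mul_of_nonneg_left (hξ.trans ?_) (norm_nonneg _)
    have : ((c : ℂ) * (1 + (‖φ ξ‖ : ℂ))) = ((c * (1 + ‖φ ξ‖) : ℝ) : ℂ) := by push_cast; rfl
    rw [this, Complex.norm_real]
    exact le_abs_self _

/-- Differentiation under the integral sign for a family of tempered functions `a t` whose time
derivative is dominated by `1 + |φ|`, locally uniformly in time. -/
theorem hasDerivAt_fourierInv_regDist {φ : ℝ → ℂ} (hφ : IsTempered φ) {a a' : ℝ → ℝ → ℂ}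
    (ha : ∀ t, IsTempered (a t)) (ha' : ∀ t, IsTempered (a' t))
    (hd : ∀ᵐ ξ, ∀ t, HasDerivAt (fun s => a s ξ) (a' t ξ) t)
    (hb : ∀ T : ℝ, ∃ c : ℝ, ∀ᵐ ξ, ∀ s, |s| ≤ T → ‖a' s ξ‖ ≤ c * (1 + ‖φ ξ‖))
    (t : ℝ) (χ : 𝓢(ℝ, ℂ)) :
    HasDerivAt (fun s => 𝓕⁻ (regDist (a s) (ha s)) χ) (𝓕⁻ (regDist (a' t) (ha' t)) χ) t := by
  simp only [TemperedDistribution.fourierInv_apply, regDist_apply]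
  obtain ⟨c, hc⟩ := hb (|t| + 1)
  have hG : IsTempered (fun ξ => ((c * (1 + ‖φ ξ‖) : ℝ) : ℂ)) := by
    refine isTempered_of_norm_le_symbol hφ ?_ |c| (Eventually.of_forall fun ξ => ?_)
    · exact (by fun_prop : Continuous fun z : ℂ => ((c * (1 + ‖z‖) : ℝ) : ℂ))
        |>.comp_aestronglyMeasurable hφ.aestronglyMeasurable
    · rw [Complex.norm_real, norm_mul, Real.norm_eq_abs, Real.norm_of_nonneg (by positivity)]
  refine (hasDerivAt_integral_of_dominated_loc_of_deriv_le (s := Metric.ball t 1)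
    (F := fun s ξ => (𝓕⁻ χ) ξ * a s ξ) (F' := fun s ξ => (𝓕⁻ χ) ξ * a' s ξ)
    (bound := fun ξ => ‖(𝓕⁻ χ) ξ * ((c * (1 + ‖φ ξ‖) : ℝ) : ℂ)‖)
    (Metric.ball_mem_nhds t one_pos) (Eventually.of_forall fun s => ?_) ?_ ?_ ?_ ?_ ?_).2
  · exact ((ha s).integrable_mul _).aestronglyMeasurable
  · exact (ha t).integrable_mul _
  · exact ((ha' t).integrable_mul _).aestronglyMeasurable
  · filter_upwards [hc] with ξ hξ s hs
    rw [norm_mul, norm_mul, Complex.norm_real]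
    gcongr
    refine (hξ s ?_).trans (le_abs_self _)
    have h1 : |s - t| < 1 := by simpa [Real.dist_eq] using hs
    have h2 := abs_sub_abs_le_abs_sub s t
    linarith
  · exact (hG.integrable_mul _).norm
  · filter_upwards [hd] with ξ hξ s _
    exact (hξ s).const_mul _

/-- The Fourier transform of the solution with data whose Fourier transforms are `p` and `q`. -/
def solHat (φ p q : ℝ → ℂ) (t ξ : ℝ) : ℂ := cosSymbol φ t ξ * p ξ + sinSymbol φ t ξ * q ξ

/-- The time derivative of `solHat`. -/
def velHat (φ p q : ℝ → ℂ) (t ξ : ℝ) : ℂ := cosSymbolDeriv φ t ξ * p ξ + cosSymbol φ t ξ * q ξ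

section Existence

variable {φ : ℝ → ℂ} (p q : 𝓢(ℝ, ℂ))

theorem aestronglyMeasurable_solHat (hφ : AEStronglyMeasurable φ) (t : ℝ) :
    AEStronglyMeasurable (solHat φ p q t) :=
  ((aestronglyMeasurable_cosSymbol hφ t).mul p.continuous.aestronglyMeasurable).add
    ((aestronglyMeasurable_sinSymbol hφ t).mul q.continuous.aestronglyMeasurable)

theorem aestronglyMeasurable_velHat (hφ : AEStronglyMeasurable φ) (t : ℝ) :
    AEStronglyMeasurable (velHat φ p q t) := by
  have hf : AEStronglyMeasurable (fun ξ => ((freq φ ξ : ℝ) : ℂ)) :=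
    Complex.continuous_ofReal.comp_aestronglyMeasurable (aestronglyMeasurable_freq hφ)
  exact (((((aestronglyMeasurable_sinSymbol hφ t).mul hf).mul hf).neg).mul
    p.continuous.aestronglyMeasurable).add
    ((aestronglyMeasurable_cosSymbol hφ t).mul q.continuous.aestronglyMeasurable)

theorem exists_norm_le_and_norm_le : ∃ P : ℝ, 0 ≤ P ∧ ∀ ξ, ‖p ξ‖ ≤ P ∧ ‖q ξ‖ ≤ P :=
  ⟨max (SchwartzMap.seminorm ℂ 0 0 p) (SchwartzMap.seminorm ℂ 0 0 q),
    le_max_of_le_left (apply_nonneg _ _), fun ξ =>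
    ⟨(norm_le_seminorm ℂ p ξ).trans (le_max_left _ _),
      (norm_le_seminorm ℂ q ξ).trans (le_max_right _ _)⟩⟩

variable (φ) in
theorem exists_norm_solHat_le : ∃ P : ℝ, 0 ≤ P ∧
    ∀ T t : ℝ, |t| ≤ T → ∀ ξ, ‖solHat φ p q t ξ‖ ≤ P * (1 + T) := by
  obtain ⟨P, hP0, hP⟩ := exists_norm_le_and_norm_le p q
  refine ⟨P, hP0, fun T t ht ξ => (norm_add_le _ _).trans ?_⟩
  rw [norm_mul, norm_mul]
  have h1 := mul_le_mul (norm_cosSymbol_le φ t ξ) (hP ξ).1 (norm_nonneg _) zero_le_one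
  have h2 := mul_le_mul ((norm_sinSymbol_le φ t ξ).trans ht) (hP ξ).2 (norm_nonneg _)
    ((abs_nonneg t).trans ht)
  linarith

theorem exists_norm_velHat_le : ∃ P : ℝ, 0 ≤ P ∧
    ∀ t ξ, 0 ≤ φ ξ → ‖velHat φ p q t ξ‖ ≤ P * (1 + ‖φ ξ‖) := by
  obtain ⟨P, hP0, hP⟩ := exists_norm_le_and_norm_le p q
  refine ⟨2 * P, by positivity, fun t ξ hξ => (norm_add_le _ _).trans ?_⟩
  rw [norm_mul, norm_mul]
  have h1 := mul_le_mul (norm_cosSymbolDeriv_le hξ t) (hP ξ).1 (norm_nonneg _) (by positivity)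
  have h2 := mul_le_mul (norm_cosSymbol_le φ t ξ) (hP ξ).2 (norm_nonneg _) zero_le_one
  nlinarith [norm_nonneg (φ ξ), mul_nonneg hP0 (norm_nonneg (φ ξ))]

theorem isTempered_solHat (hφ : AEStronglyMeasurable φ) (t : ℝ) :
    IsTempered (solHat φ p q t) := by
  obtain ⟨P, -, hP⟩ := exists_norm_solHat_le φ p q
  exact isTempered_of_norm_le (aestronglyMeasurable_solHat p q hφ t)
    (Eventually.of_forall (hP |t| t le_rfl))

theorem isTempered_velHat (hφ : IsTempered φ) (h0 : ∀ᵐ ξ, 0 ≤ φ ξ) (t : ℝ) :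
    IsTempered (velHat φ p q t) := by
  obtain ⟨P, -, hP⟩ := exists_norm_velHat_le (φ := φ) p q
  exact isTempered_of_norm_le_symbol hφ
    (aestronglyMeasurable_velHat p q hφ.aestronglyMeasurable t) P (h0.mono fun ξ => hP t ξ)

theorem isTempered_symbol_mul_solHat (hφ : IsTempered φ) (t : ℝ) :
    IsTempered (fun ξ => φ ξ * solHat φ p q t ξ) := by
  obtain ⟨P, -, hP⟩ := exists_norm_solHat_le φ p q
  simp_rw [mul_comm (φ _)]
  exact hφ.mul_of_norm_le (aestronglyMeasurable_solHat p q hφ.aestronglyMeasurable t)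
    (Eventually.of_forall (hP |t| t le_rfl))

theorem fourierInv_regDist_fourier (f : 𝓢(ℝ, ℂ)) {g : ℝ → ℂ} (hg : IsTempered g)
    (h : ∀ ξ, g ξ = 𝓕 f ξ) :
    𝓕⁻ (regDist g hg) = SchwartzMap.toTemperedDistributionCLM ℝ ℂ volume f := by
  ext χ
  have h1 := toTemperedDistributionCLM_apply_apply volume f χ
  rw [TemperedDistribution.fourierInv_apply, regDist_apply]
  refine Eq.trans ?_ h1.symm
  simp only [h, smul_eq_mul]
  rw [← integral_fourier_mul_eq, FourierTransform.fourier_fourierInv_eq]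

theorem isSolution_fourierInv_solHat {ν : 𝓢'(ℝ, ℂ)} (hν : IsFunction (𝓕 ν) φ)
    (hφ : IsTempered φ) (h0 : ∀ᵐ ξ, 0 ≤ φ ξ) (u₀ u₁ : 𝓢(ℝ, ℂ)) :
    IsSolution ν u₀ u₁ (fun t =>
      𝓕⁻ (regDist _ (isTempered_solHat (𝓕 u₀) (𝓕 u₁) hφ.aestronglyMeasurable t))) := by
  generalize hp : 𝓕 u₀ = p
  generalize hq : 𝓕 u₁ = q
  have hw := isTempered_symbol_mul_solHat p q hφ
  have hwn : ∀ t, IsTempered (fun ξ => -(φ ξ * solHat φ p q t ξ)) := fun t => by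
    simpa using (hw t).mul_of_norm_le (b := fun _ => -1) aestronglyMeasurable_const (B := 1)
      (by simp)
  obtain ⟨P, hP0, hP⟩ := exists_norm_solHat_le φ p q
  refine ⟨fun t => 𝓕⁻ (regDist _ (isTempered_velHat p q hφ h0 t)),
    fun t => 𝓕⁻ (regDist _ (hw t)), ?_, ?_, ?_, ?_, ?_, ?_⟩
  · refine hasDerivAt_fourierInv_regDist hφ _ _ (Eventually.of_forall fun ξ t => ?_) fun T => ?_
    · exact ((hasDerivAt_cosSymbol φ t ξ).mul_const _).add
        ((hasDerivAt_sinSymbol φ t ξ).mul_const _)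
    · obtain ⟨P, -, hP⟩ := exists_norm_velHat_le (φ := φ) p q
      exact ⟨P, h0.mono fun ξ hξ s _ => hP s ξ hξ⟩
  · have := hasDerivAt_fourierInv_regDist hφ (isTempered_velHat p q hφ h0) hwn
      (h0.mono fun ξ hξ t => ?_) fun T => ⟨P * (1 + |T|), Eventually.of_forall fun ξ s hs => ?_⟩
    · intro t χ
      refine (this t χ).congr_deriv ?_
      have hn : (-𝓕⁻ (regDist _ (hw t)) : 𝓢'(ℝ, ℂ)) χ = -(𝓕⁻ (regDist _ (hw t)) χ) := rfl
      rw [hn]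
      simp only [TemperedDistribution.fourierInv_apply, regDist_apply, mul_neg, integral_neg]
    · refine (((hasDerivAt_cosSymbolDeriv hξ t).mul_const _).add
        ((hasDerivAt_cosSymbol φ t ξ).mul_const _)).congr_deriv ?_
      rw [cosSymbolDeriv_eq hξ, solHat]
      ring
    · rw [norm_neg, norm_mul, mul_comm]
      have := hP |T| s (hs.trans (le_abs_self T)) ξ
      gcongr
      linarith
  · intro t
    refine ⟨φ, solHat φ p q t, hν, ?_, ?_⟩
    · rw [FourierTransform.fourier_fourierInv_eq]
      exact isFunction_regDist _
    · rw [FourierTransform.fourier_fourierInv_eq]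
      exact isFunction_regDist _
  · intro T R
    refine ⟨∫ ξ in Set.Icc (-R) R, P * (1 + |T|) * ‖φ ξ‖, fun t ht =>
      ⟨fun ξ => φ ξ * solHat φ p q t ξ, ?_, ?_⟩⟩
    · rw [FourierTransform.fourier_fourierInv_eq]
      exact isFunction_regDist _
    · refine integral_mono
        ((hw t).locallyIntegrable.integrableOn_isCompact isCompact_Icc).norm
        ((hν.1.integrableOn_isCompact isCompact_Icc).norm.const_mul _) fun ξ => ?_
      simp only [norm_mul]
      rw [mul_comm]
      gcongr
      exact hP |T| t ((abs_le.2 ht).trans (le_abs_self T)) ξ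
  · exact fourierInv_regDist_fourier u₀ _ fun ξ => by simp [hp, solHat, cosSymbol, sinSymbol]
  · exact fourierInv_regDist_fourier u₁ _ fun ξ => by
      simp [hq, velHat, cosSymbolDeriv, cosSymbol, sinSymbol]

theorem continuous_fourierInv_of_integrable {f : ℝ → ℂ} (hf : Integrable f) :
    Continuous (𝓕⁻ f : ℝ → ℂ) :=
  VectorFourier.fourierIntegral_continuous Real.continuous_fourierChar
    (by fun_prop) hf

/-- On the Fourier side, convolution with the propagators is multiplication by their symbols. -/
theorem isFunction_fourierInv_solHat (hφ : AEStronglyMeasurable φ) (u₀ u₁ : 𝓢(ℝ, ℂ)) (t : ℝ) :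
    IsFunction (𝓕⁻ (regDist _ (isTempered_solHat (𝓕 u₀) (𝓕 u₁) hφ t)))
      (fun x => conv (𝓕⁻ (regDist _ (isTempered_cosSymbol hφ t))) u₀ x
        + conv (𝓕⁻ (regDist _ (isTempered_sinSymbol hφ t))) u₁ x) := by
  simp only [conv_eq_of_isTempered _ (FourierTransform.fourier_fourierInv_eq _)]
  have hc : Integrable (fun ξ => 𝓕 u₀ ξ * cosSymbol φ t ξ) :=
    (isTempered_cosSymbol hφ t).integrable_mul (𝓕 u₀)
  have hs : Integrable (fun ξ => 𝓕 u₁ ξ * sinSymbol φ t ξ) :=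
    (isTempered_sinSymbol hφ t).integrable_mul (𝓕 u₁)
  have hcc := continuous_fourierInv_of_integrable hc
  have hsc := continuous_fourierInv_of_integrable hs
  refine ⟨(hcc.add hsc).locallyIntegrable, fun χ hχ => ?_⟩
  rw [TemperedDistribution.fourierInv_apply, regDist_apply]
  simp only [mul_add]
  rw [integral_add (integrable_mul_of_hasCompactSupport hcc.locallyIntegrable χ.continuous hχ)
    (integrable_mul_of_hasCompactSupport hsc.locallyIntegrable χ.continuous hχ),
    ← integral_fourierInv_mul_eq_of_integrable χ.integrable hc,
    ← integral_fourierInv_mul_eq_of_integrable χ.integrable hs, ← fourierInv_coe, ← integral_add]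
  · congr 1
    ext ξ
    rw [solHat]
    ring
  · exact hc.bdd_mul (𝓕⁻ χ).continuous.aestronglyMeasurable
      (Eventually.of_forall (norm_le_seminorm ℂ (𝓕⁻ χ)))
  · exact hs.bdd_mul (𝓕⁻ χ).continuous.aestronglyMeasurable
      (Eventually.of_forall (norm_le_seminorm ℂ (𝓕⁻ χ)))

end Existence

/-! ### Uniqueness of solutions -/

/-- Mollification: a bounded measurable function of bounded support is the almost everywhere limit
of smooth functions with the same bound and uniformly bounded supports. -/
theorem exists_smooth_approximation {χ : ℝ → ℂ} (hχ : AEStronglyMeasurable χ) {B R : ℝ}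
    (hB : ∀ x, ‖χ x‖ ≤ B) (hR : ∀ x, R < |x| → χ x = 0) :
    ∃ χn : ℕ → ℝ → ℂ, (∀ n, ContDiff ℝ ∞ (χn n)) ∧ (∀ n x, ‖χn n x‖ ≤ B) ∧
      (∀ n x, R + 2 < |x| → χn n x = 0) ∧
      ∀ᵐ x, Tendsto (fun n => χn n x) atTop (𝓝 (χ x)) := by
  let b : ℕ → ContDiffBump (0 : ℝ) := fun n =>
    ⟨1 / ((n : ℝ) + 1), 2 * (1 / ((n : ℝ) + 1)), by positivity, by
      have : 0 < 1 / ((n : ℝ) + 1) := by positivity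
      linarith⟩
  have hb : Tendsto (fun n => (b n).rOut) atTop (𝓝 0) := by
    simpa [b] using (tendsto_one_div_add_atTop_nhds_zero_nat (𝕜 := ℝ)).const_mul 2
  have hb2 : ∀ n, (b n).rOut ≤ 2 := fun n => by
    have : 1 / ((n : ℝ) + 1) ≤ 1 := by
      rw [div_le_one (by positivity)]; linarith [n.cast_nonneg (α := ℝ)]
    change 2 * (1 / ((n : ℝ) + 1)) ≤ 2
    linarith
  have hloc : LocallyIntegrable χ :=
    (isTempered_of_norm_le hχ (Eventually.of_forall hB)).locallyIntegrable
  refine ⟨fun n => convolution ((b n).normed volume) χ (ContinuousLinearMap.lsmul ℝ ℝ) volume,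
    fun n => ?_, fun n x => ?_, fun n x hx => ?_, ?_⟩
  · exact (b n).hasCompactSupport_normed.contDiff_convolution_left _ (b n).contDiff_normed hloc
  · beta_reduce
    rw [convolution_def]
    refine (norm_integral_le_of_norm_le ((b n).integrable_normed.mul_const B)
      (Eventually.of_forall fun t => ?_)).trans ?_
    · rw [ContinuousLinearMap.lsmul_apply, norm_smul, Real.norm_of_nonneg ((b n).nonneg_normed _)]
      exact mul_le_mul_of_nonneg_left (hB _) ((b n).nonneg_normed _)
    · rw [integral_mul_const, (b n).integral_normed, one_mul]
  · beta_reduce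
    rw [convolution_def]
    refine integral_eq_zero_of_ae (Eventually.of_forall fun t => ?_)
    beta_reduce
    rw [ContinuousLinearMap.lsmul_apply]
    by_cases ht : |t| < 2
    · have : R < |x - t| := by
        have := abs_sub_abs_le_abs_sub x t
        linarith
      simp [hR _ this]
    · have : (b n).normed volume t = 0 := by
        have h1 : t ∉ Function.support ((b n).normed volume) := by
          rw [(b n).support_normed_eq, mem_ball_zero_iff, Real.norm_eq_abs]
          linarith [hb2 n]
        simpa using h1
      simp [this]
  · exact ContDiffBump.ae_convolution_tendsto_right_of_locallyIntegrable (K := 2) hb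
      (Eventually.of_forall fun n => le_rfl) hloc

section Pairing

variable {h χ : ℝ → ℂ} {B R : ℝ}

theorem norm_mul_le_indicator (hB : ∀ x, ‖χ x‖ ≤ B) (hR : ∀ x, R < |x| → χ x = 0) (x : ℝ) :
    ‖χ x * h x‖ ≤ (Set.Icc (-R) R).indicator (fun x => B * ‖h x‖) x := by
  by_cases hx : x ∈ Set.Icc (-R) R
  · rw [Set.indicator_of_mem hx, norm_mul]
    exact mul_le_mul_of_nonneg_right (hB x) (norm_nonneg _)
  · rw [Set.indicator_of_notMem hx, hR x]
    · simp
    · rw [Set.mem_Icc, ← abs_le] at hx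
      exact not_le.1 hx

theorem integrable_indicator_norm (hh : LocallyIntegrable h) (B R : ℝ) :
    Integrable ((Set.Icc (-R) R).indicator (fun x => B * ‖h x‖)) :=
  (integrable_indicator_iff measurableSet_Icc).2
    ((hh.integrableOn_isCompact isCompact_Icc).norm.const_mul B)

theorem norm_integral_mul_le (hh : LocallyIntegrable h) (hB : ∀ x, ‖χ x‖ ≤ B)
    (hR : ∀ x, R < |x| → χ x = 0) :
    ‖∫ x, χ x * h x‖ ≤ B * ∫ x in Set.Icc (-R) R, ‖h x‖ := by
  refine (norm_integral_le_of_norm_le (integrable_indicator_norm hh B R)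
    (Eventually.of_forall (norm_mul_le_indicator hB hR))).trans ?_
  rw [integral_indicator measurableSet_Icc, integral_const_mul]

theorem tendsto_integral_mul (hh : LocallyIntegrable h) {χn : ℕ → ℝ → ℂ}
    (hm : ∀ n, AEStronglyMeasurable (χn n)) (hB : ∀ n x, ‖χn n x‖ ≤ B)
    (hR : ∀ n x, R < |x| → χn n x = 0)
    (ht : ∀ᵐ x, Tendsto (fun n => χn n x) atTop (𝓝 (χ x))) :
    Tendsto (fun n => ∫ x, χn n x * h x) atTop (𝓝 (∫ x, χ x * h x)) := by
  refine tendsto_integral_of_dominated_convergence _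
    (fun n => (hm n).mul hh.aestronglyMeasurable) (integrable_indicator_norm hh B R)
    (fun n => Eventually.of_forall (norm_mul_le_indicator (hB n) (hR n))) ?_
  filter_upwards [ht] with x hx
  exact hx.mul_const _

end Pairing

/-- A family `g t` of locally integrable functions that solves `g'' + φ g = 0` with zero initial
data, in the integrated form `g t = -∫₀ᵗ (t - s) φ g s ds`, tested against smooth functions of
compact support. Measurability in time is required only after pairing with a test function; no
joint measurability of `g` is assumed. -/
structure IsNullSolution (φ : ℝ → ℂ) (g : ℝ → ℝ → ℂ) : Prop where
  stronglyMeasurable : StronglyMeasurable φ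
  locallyIntegrable : ∀ t, LocallyIntegrable (g t)
  locallyIntegrable_mul : ∀ t, LocallyIntegrable (fun ξ => φ ξ * g t ξ)
  bounded : ∀ T R : ℝ, ∃ C : ℝ, ∀ t ∈ Set.Icc (-T) T,
    ∫ ξ in Set.Icc (-R) R, ‖φ ξ * g t ξ‖ ≤ C
  measurable : ∀ χ : ℝ → ℂ, ContDiff ℝ ∞ χ → HasCompactSupport χ →
    StronglyMeasurable (fun s => ∫ ξ, χ ξ * (φ ξ * g s ξ))
  integral_eq : ∀ χ : ℝ → ℂ, ContDiff ℝ ∞ χ → HasCompactSupport χ → ∀ t,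
    ∫ ξ, χ ξ * g t ξ = -∫ s in (0 : ℝ)..t, ((t - s : ℝ) : ℂ) * ∫ ξ, χ ξ * (φ ξ * g s ξ)

namespace IsNullSolution

variable {φ : ℝ → ℂ} {g : ℝ → ℝ → ℂ}

theorem comp_neg (hg : IsNullSolution φ g) : IsNullSolution φ (fun t => g (-t)) where
  stronglyMeasurable := hg.stronglyMeasurable
  locallyIntegrable t := hg.locallyIntegrable (-t)
  locallyIntegrable_mul t := hg.locallyIntegrable_mul (-t)
  bounded T R := by
    obtain ⟨C, hC⟩ := hg.bounded T R
    exact ⟨C, fun t ht => hC (-t) ⟨by linarith [ht.2], by linarith [ht.1]⟩⟩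
  measurable χ h1 h2 := (hg.measurable χ h1 h2).comp_measurable measurable_neg
  integral_eq χ h1 h2 t := by
    have h := intervalIntegral.integral_comp_neg (a := 0) (b := t)
      (fun s => ((-t - s : ℝ) : ℂ) * ∫ ξ, χ ξ * (φ ξ * g s ξ))
    rw [hg.integral_eq χ h1 h2 (-t), intervalIntegral.integral_symm, ← neg_zero, ← h,
      neg_neg, neg_zero, ← intervalIntegral.integral_neg]
    refine intervalIntegral.integral_congr fun s _ => ?_
    push_cast
    ring

/-- By approximation, the integrated equation holds for all bounded measurable test functions of
bounded support. -/
theorem integral_eq_of_bounded (hg : IsNullSolution φ g) {χ : ℝ → ℂ}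
    (hχ : AEStronglyMeasurable χ) {B R : ℝ} (hB : ∀ x, ‖χ x‖ ≤ B)
    (hR : ∀ x, R < |x| → χ x = 0) (t : ℝ) :
    ∫ ξ, χ ξ * g t ξ = -∫ s in (0 : ℝ)..t, ((t - s : ℝ) : ℂ) * ∫ ξ, χ ξ * (φ ξ * g s ξ) := by
  obtain ⟨χn, h1, h2, h3, h4⟩ := exists_smooth_approximation hχ hB hR
  have hB0 : 0 ≤ B := (norm_nonneg _).trans (hB 0)
  have hc : ∀ n, HasCompactSupport (χn n) := fun n => by
    refine HasCompactSupport.intro (isCompact_Icc (a := -(R + 2)) (b := R + 2)) fun x hx => ?_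
    rw [Set.mem_Icc, ← abs_le] at hx
    exact h3 n x (not_le.1 hx)
  have hm : ∀ n, AEStronglyMeasurable (χn n) := fun n => (h1 n).continuous.aestronglyMeasurable
  have hl := tendsto_integral_mul (hg.locallyIntegrable t) hm h2 h3 h4
  refine tendsto_nhds_unique hl ?_
  simp_rw [fun n => hg.integral_eq (χn n) (h1 n) (hc n) t]
  refine Tendsto.neg ?_
  obtain ⟨C, hC⟩ := hg.bounded |t| (R + 2)
  refine intervalIntegral.tendsto_integral_filter_of_dominated_convergence
    (fun _ => |t| * (B * C)) (Eventually.of_forall fun n => ?_)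
    (Eventually.of_forall fun n => Eventually.of_forall fun s hs => ?_)
    intervalIntegrable_const (Eventually.of_forall fun s _ => ?_)
  · exact ((by fun_prop : Continuous fun s : ℝ => ((t - s : ℝ) : ℂ)).stronglyMeasurable.mul
      (hg.measurable _ (h1 n) (hc n))).aestronglyMeasurable
  · have hs' : |s| ≤ |t| ∧ |t - s| ≤ |t| := by
      rcases le_total 0 t with h0 | h0
      · rw [Set.uIoc_of_le h0] at hs
        rw [abs_of_nonneg h0, abs_le, abs_le]
        exact ⟨⟨by linarith [hs.1], hs.2⟩, ⟨by linarith [hs.2], by linarith [hs.1]⟩⟩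
      · rw [Set.uIoc_of_ge h0] at hs
        rw [abs_of_nonpos h0, abs_le, abs_le]
        exact ⟨⟨by linarith [hs.1], by linarith [hs.2]⟩, ⟨by linarith [hs.2], by linarith [hs.1]⟩⟩
    rw [norm_mul, Complex.norm_real, Real.norm_eq_abs]
    refine mul_le_mul hs'.2 ?_ (norm_nonneg _) (abs_nonneg _)
    refine (norm_integral_mul_le (hg.locallyIntegrable_mul s) (h2 n) (h3 n)).trans ?_
    exact mul_le_mul_of_nonneg_left (hC s (abs_le.1 hs'.1)) hB0
  · exact (tendsto_integral_mul (hg.locallyIntegrable_mul s) hm h2 h3 h4).const_mul _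

/-- Iterating the integrated equation on a set where `φ` is bounded gives factorial decay. -/
theorem norm_integral_le (hg : IsNullSolution φ g) (M R T : ℝ) (hM : 0 ≤ M) (hT : 0 ≤ T) :
    ∃ K : ℝ, 0 ≤ K ∧ ∀ (k : ℕ) (χ : ℝ → ℂ) (B : ℝ), AEStronglyMeasurable χ →
      (∀ x, ‖χ x‖ ≤ B) → (∀ x, R < |x| → χ x = 0) → (∀ x, M < ‖φ x‖ → χ x = 0) →
      ∀ t ∈ Set.Icc 0 T,
        ‖∫ ξ, χ ξ * g t ξ‖ ≤ B * K * (M * T) ^ k * (t ^ k / k.factorial) := by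
  obtain ⟨C, hC⟩ := hg.bounded T R
  refine ⟨T * T * |C|, by positivity, fun k => ?_⟩
  induction k with
  | zero =>
    intro χ B hχ hB hR _ t ht
    have hB0 : 0 ≤ B := (norm_nonneg _).trans (hB 0)
    rw [hg.integral_eq_of_bounded hχ hB hR, norm_neg]
    refine (intervalIntegral.norm_integral_le_of_norm_le_const (C := T * (B * |C|))
      fun s hs => ?_).trans ?_
    · rw [Set.uIoc_of_le ht.1] at hs
      rw [norm_mul, Complex.norm_real, Real.norm_of_nonneg (by linarith [hs.2])]
      refine mul_le_mul (by linarith [hs.1, ht.2]) ?_ (norm_nonneg _) hT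
      refine (norm_integral_mul_le (hg.locallyIntegrable_mul s) hB hR).trans ?_
      refine mul_le_mul_of_nonneg_left ((hC s ⟨?_, ?_⟩).trans (le_abs_self C)) hB0
      · linarith [hs.1]
      · linarith [hs.2, ht.2]
    · rw [sub_zero, abs_of_nonneg ht.1]
      calc T * (B * |C|) * t ≤ T * (B * |C|) * T := by gcongr; exact ht.2
        _ = _ := by simp; ring
  | succ k ih =>
    intro χ B hχ hB hR hA t ht
    have hB0 : 0 ≤ B := (norm_nonneg _).trans (hB 0)
    rw [hg.integral_eq_of_bounded hχ hB hR, norm_neg]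
    have hK : 0 ≤ T * T * |C| := by positivity
    generalize T * T * |C| = K at ih hK ⊢
    refine (intervalIntegral.norm_integral_le_of_norm_le ht.1
      (g := fun s => B * K * (M * T) ^ (k + 1) / k.factorial * s ^ k)
      (Eventually.of_forall fun s hs => ?_) ?_).trans ?_
    · rw [norm_mul, Complex.norm_real, Real.norm_of_nonneg (by linarith [hs.2])]
      have h1 : ‖∫ ξ, χ ξ * (φ ξ * g s ξ)‖ ≤
          B * M * K * (M * T) ^ k * (s ^ k / k.factorial) := by
        simp_rw [← mul_assoc]
        refine (ih (fun ξ => χ ξ * φ ξ) (B * M)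
          (hχ.mul hg.stronglyMeasurable.aestronglyMeasurable) (fun x => ?_)
          (fun x hx => by simp [hR x hx]) (fun x hx => by simp [hA x hx]) s
          ⟨hs.1.le, hs.2.trans ht.2⟩).trans_eq (by ring)
        rcases lt_or_ge M ‖φ x‖ with hx | hx
        · simp only [hA x hx, zero_mul, norm_zero]; positivity
        · rw [norm_mul]
          exact mul_le_mul (hB x) hx (norm_nonneg _) hB0
      calc (t - s) * ‖∫ ξ, χ ξ * (φ ξ * g s ξ)‖
          ≤ T * (B * M * K * (M * T) ^ k * (s ^ k / k.factorial)) :=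
            mul_le_mul (by linarith [hs.1, ht.2]) h1 (norm_nonneg _) hT
        _ = _ := by rw [pow_succ]; ring
    · exact (by fun_prop : Continuous fun s : ℝ =>
        B * K * (M * T) ^ (k + 1) / k.factorial * s ^ k).intervalIntegrable _ _
    · rw [intervalIntegral.integral_const_mul, integral_pow, Nat.factorial_succ]
      refine le_of_eq ?_
      push_cast
      have : (k.factorial : ℝ) ≠ 0 := by positivity
      have : (k : ℝ) + 1 ≠ 0 := by positivity
      field_simp
      ring

theorem integral_eq_zero (hg : IsNullSolution φ g) {M R : ℝ} (hM : 0 ≤ M) {χ : ℝ → ℂ} {B : ℝ}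
    (hχ : AEStronglyMeasurable χ) (hB : ∀ x, ‖χ x‖ ≤ B) (hR : ∀ x, R < |x| → χ x = 0)
    (hA : ∀ x, M < ‖φ x‖ → χ x = 0) {t : ℝ} (ht : 0 ≤ t) : ∫ ξ, χ ξ * g t ξ = 0 := by
  obtain ⟨K, -, hK⟩ := hg.norm_integral_le M R t hM ht
  have h1 : Tendsto (fun k : ℕ => B * K * ((M * t * t) ^ k / k.factorial)) atTop (𝓝 0) := by
    simpa using (FloorSemiring.tendsto_pow_div_factorial_atTop (M * t * t)).const_mul (B * K)
  rw [← norm_le_zero_iff]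
  refine ge_of_tendsto' h1 fun k => (hK k χ B hχ hB hR hA t ⟨ht, le_rfl⟩).trans_eq ?_
  rw [mul_pow (M * t) t]
  ring

/-- The sets where `|φ| ≤ n` and `|ξ| ≤ n` exhaust the line, and on each of them `g t` has zero
integral over all measurable subsets. -/
theorem ae_eq_zero_of_nonneg (hg : IsNullSolution φ g) {t : ℝ} (ht : 0 ≤ t) :
    g t =ᵐ[volume] 0 := by
  let A : ℕ → Set ℝ := fun n => {ξ | ‖φ ξ‖ ≤ n} ∩ Set.Icc (-(n : ℝ)) n
  have hA : ∀ n, MeasurableSet (A n) := fun n =>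
    (measurableSet_le hg.stronglyMeasurable.norm.measurable measurable_const).inter
      measurableSet_Icc
  have h1 : ∀ n, ∀ᵐ ξ, ξ ∈ A n → g t ξ = 0 := by
    intro n
    rw [← ae_restrict_iff' (hA n)]
    refine Integrable.ae_eq_zero_of_forall_setIntegral_eq_zero
      (((hg.locallyIntegrable t).integrableOn_isCompact isCompact_Icc).mono_set
        Set.inter_subset_right) fun s hs _ => ?_
    rw [Measure.restrict_restrict hs]
    have h2 := hg.integral_eq_zero (M := n) (R := n) (B := 1) n.cast_nonneg
      (χ := (s ∩ A n).indicator fun _ => 1)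
      ((stronglyMeasurable_const.indicator (hs.inter (hA n))).aestronglyMeasurable)
      (fun x => (norm_indicator_le_norm_self _ x).trans (by simp))
      (fun x hx => Set.indicator_of_notMem (fun h => not_lt.2 (abs_le.2 h.2.2) hx) _)
      (fun x hx => Set.indicator_of_notMem (fun h => not_lt.2 h.2.1 hx) _) ht
    rw [← integral_indicator (hs.inter (hA n)), ← h2]
    congr 1
    ext ξ
    by_cases hξ : ξ ∈ s ∩ A n <;> simp [hξ]
  filter_upwards [ae_all_iff.2 h1] with ξ hξ
  obtain ⟨n, hn⟩ := exists_nat_ge (max ‖φ ξ‖ |ξ|)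
  exact hξ n ⟨(le_max_left _ _).trans hn, abs_le.1 ((le_max_right _ _).trans hn)⟩

theorem ae_eq_zero (hg : IsNullSolution φ g) (t : ℝ) : g t =ᵐ[volume] 0 := by
  rcases le_total 0 t with h | h
  · exact hg.ae_eq_zero_of_nonneg h
  · simpa using hg.comp_neg.ae_eq_zero_of_nonneg (t := -t) (by linarith)

end IsNullSolution

/-- Taylor's formula for `U'' = -W` with zero initial data; the function `(t - s) V s + U s` is a
primitive of `-(t - s) W s`. No continuity of `W` is needed. -/
theorem eq_neg_integral_of_hasDerivAt {U V W : ℝ → ℂ} (hU : ∀ t, HasDerivAt U (V t) t)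
    (hV : ∀ t, HasDerivAt V (-(W t)) t) (hU0 : U 0 = 0) (hV0 : V 0 = 0) (hW : StronglyMeasurable W)
    (t : ℝ) (hb : ∃ C : ℝ, ∀ s ∈ Set.Icc (-|t|) |t|, ‖W s‖ ≤ C) :
    U t = -∫ s in (0 : ℝ)..t, ((t - s : ℝ) : ℂ) * W s := by
  obtain ⟨C, hC⟩ := hb
  have hsub : ∀ s ∈ Set.uIcc 0 t, s ∈ Set.Icc (-|t|) |t| := fun s hs => by
    rw [Set.mem_Icc, ← abs_le]
    simpa using Set.abs_sub_left_of_mem_uIcc hs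
  have hd : ∀ s ∈ Set.uIcc 0 t, HasDerivAt (fun s => ((t - s : ℝ) : ℂ) * V s + U s)
      (-(((t - s : ℝ) : ℂ) * W s)) s := by
    intro s _
    have h1 : HasDerivAt (fun s : ℝ => ((t - s : ℝ) : ℂ)) ((-1 : ℝ) : ℂ) s :=
      ((hasDerivAt_id s).const_sub t).ofReal_comp
    refine ((h1.mul (hV s)).add (hU s)).congr_deriv ?_
    push_cast
    ring
  have hi : IntervalIntegrable (fun s => -(((t - s : ℝ) : ℂ) * W s)) volume 0 t := by
    refine IntervalIntegrable.neg ?_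
    refine IntervalIntegrable.continuousOn_mul (g := fun s : ℝ => ((t - s : ℝ) : ℂ)) ?_
      (by fun_prop)
    refine (intervalIntegrable_const (c := C)).mono_fun' hW.aestronglyMeasurable ?_
    filter_upwards [ae_restrict_mem measurableSet_uIoc] with s hs
    exact hC s (hsub s (Set.uIoc_subset_uIcc hs))
  have h := intervalIntegral.integral_eq_sub_of_hasDerivAt hd hi
  rw [intervalIntegral.integral_neg] at h
  rw [h, hU0, hV0]
  simp

theorem IsConv.exists_isFunction {ν v w : 𝓢'(ℝ, ℂ)} (h : IsConv ν v w) {φ : ℝ → ℂ}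
    (hφ : IsFunction (𝓕 ν) φ) :
    ∃ g, IsFunction (𝓕 v) g ∧ IsFunction (𝓕 w) (fun ξ => φ ξ * g ξ) := by
  obtain ⟨φ', g, h1, h2, h3⟩ := h
  refine ⟨g, h2, h3.congr ?_⟩
  filter_upwards [h1.ae_eq hφ] with ξ hξ
  rw [hξ]

/-- The difference of two solutions is, on the Fourier side, a null solution, hence zero. -/
theorem isSolution_unique {ν : 𝓢'(ℝ, ℂ)} {φ : ℝ → ℂ} (hφ : IsFunction (𝓕 ν) φ)
    {u₀ u₁ : 𝓢(ℝ, ℂ)} {u u' : ℝ → 𝓢'(ℝ, ℂ)} (hu : IsSolution ν u₀ u₁ u)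
    (hu' : IsSolution ν u₀ u₁ u') : u = u' := by
  -- A strongly measurable representative of `φ`, so that its sublevel sets are measurable.
  obtain ⟨φ₀, hφ₀m, hφ₀⟩ := hφ.1.aestronglyMeasurable
  replace hφ := hφ.congr hφ₀
  obtain ⟨v, w, huv, hvw, hc, hb, hu0, hv0⟩ := hu
  obtain ⟨v', w', huv', hvw', hc', hb', hu0', hv0'⟩ := hu'
  choose g hg hφg using fun t => (hc t).exists_isFunction hφ
  choose g' hg' hφg' using fun t => (hc' t).exists_isFunction hφ
  have hloc : ∀ t, LocallyIntegrable (fun ξ => g t ξ - g' t ξ) := fun t =>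
    (hg t).1.sub (hg' t).1
  have hloc' : ∀ t, LocallyIntegrable (fun ξ => φ₀ ξ * (g t ξ - g' t ξ)) := fun t => by
    simp_rw [mul_sub]
    exact (hφg t).1.sub (hφg' t).1
  have hbound : ∀ T R : ℝ, ∃ C : ℝ, ∀ t ∈ Set.Icc (-T) T,
      ∫ ξ in Set.Icc (-R) R, ‖φ₀ ξ * (g t ξ - g' t ξ)‖ ≤ C := by
    intro T R
    obtain ⟨C, hC⟩ := hb T R
    obtain ⟨C', hC'⟩ := hb' T R
    refine ⟨C + C', fun t ht => ?_⟩
    obtain ⟨h, hh, hhC⟩ := hC t ht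
    obtain ⟨h', hh', hhC'⟩ := hC' t ht
    have hi := (hh.1.integrableOn_isCompact (isCompact_Icc (a := -R) (b := R))).norm
    have hi' := (hh'.1.integrableOn_isCompact (isCompact_Icc (a := -R) (b := R))).norm
    refine le_trans ?_ (add_le_add hhC hhC')
    rw [← integral_add hi hi']
    refine integral_mono_ae ((hloc' t).integrableOn_isCompact isCompact_Icc).norm (hi.add hi')
      (ae_restrict_of_ae ?_)
    filter_upwards [hh.ae_eq (hφg t), hh'.ae_eq (hφg' t)] with ξ h1 h2
    rw [h1, h2, mul_sub]
    exact norm_sub_le _ _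
  have hpair : ∀ (χ : 𝓢(ℝ, ℂ)) (t : ℝ), HasCompactSupport χ →
      ∫ ξ, χ ξ * (g t ξ - g' t ξ) = u t (𝓕 χ) - u' t (𝓕 χ) := by
    intro χ t hχ
    rw [← TemperedDistribution.fourier_apply, ← TemperedDistribution.fourier_apply,
      (hg t).2 χ hχ, (hg' t).2 χ hχ, ← integral_sub
      (integrable_mul_of_hasCompactSupport (hg t).1 χ.continuous hχ)
      (integrable_mul_of_hasCompactSupport (hg' t).1 χ.continuous hχ)]
    simp only [mul_sub]
  have hpair' : ∀ (χ : 𝓢(ℝ, ℂ)) (t : ℝ), HasCompactSupport χ →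
      ∫ ξ, χ ξ * (φ₀ ξ * (g t ξ - g' t ξ)) = w t (𝓕 χ) - w' t (𝓕 χ) := by
    intro χ t hχ
    rw [← TemperedDistribution.fourier_apply, ← TemperedDistribution.fourier_apply,
      (hφg t).2 χ hχ, (hφg' t).2 χ hχ, ← integral_sub
      (integrable_mul_of_hasCompactSupport (hφg t).1 χ.continuous hχ)
      (integrable_mul_of_hasCompactSupport (hφg' t).1 χ.continuous hχ)]
    simp only [mul_sub]
  have hdV : ∀ (ψ : 𝓢(ℝ, ℂ)) (t : ℝ),
      HasDerivAt (fun s => v s ψ - v' s ψ) (-(w t ψ - w' t ψ)) t := by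
    intro ψ t
    refine ((hvw t ψ).sub (hvw' t ψ)).congr_deriv ?_
    have h1 : (-w t : 𝓢'(ℝ, ℂ)) ψ = -(w t ψ) := rfl
    have h2 : (-w' t : 𝓢'(ℝ, ℂ)) ψ = -(w' t ψ) := rfl
    rw [h1, h2]
    ring
  have hmeas : ∀ ψ : 𝓢(ℝ, ℂ), StronglyMeasurable (fun t => w t ψ - w' t ψ) := by
    intro ψ
    -- This function is, up to sign, a derivative, and derivatives are measurable.
    have h1 := (stronglyMeasurable_deriv (fun s => v s ψ - v' s ψ)).neg
    have h2 : (-deriv fun s => v s ψ - v' s ψ) = fun t => w t ψ - w' t ψ := by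
      ext t
      rw [Pi.neg_apply, (hdV ψ t).deriv, neg_neg]
    rwa [h2] at h1
  have hnull : IsNullSolution φ₀ (fun t ξ => g t ξ - g' t ξ) := by
    refine ⟨hφ₀m, hloc, hloc', hbound, fun χ h1 h2 => ?_, fun χ h1 h2 t => ?_⟩
    · have he := funext fun t => hpair' (h2.toSchwartzMap h1) t h2
      have := hmeas (𝓕 (h2.toSchwartzMap h1))
      rwa [← he] at this
    · have hp := fun t => hpair (h2.toSchwartzMap h1) t h2
      have hp' := fun t => hpair' (h2.toSchwartzMap h1) t h2
      change ∀ t, ∫ ξ, χ ξ * (g t ξ - g' t ξ) = _ at hp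
      change ∀ t, ∫ ξ, χ ξ * (φ₀ ξ * (g t ξ - g' t ξ)) = _ at hp'
      simp_rw [hp, hp']
      refine eq_neg_integral_of_hasDerivAt
        (V := fun t => v t (𝓕 (h2.toSchwartzMap h1)) - v' t (𝓕 (h2.toSchwartzMap h1)))
        (U := fun t => u t (𝓕 (h2.toSchwartzMap h1)) - u' t (𝓕 (h2.toSchwartzMap h1)))
        (W := fun t => w t (𝓕 (h2.toSchwartzMap h1)) - w' t (𝓕 (h2.toSchwartzMap h1)))
        (fun t => (huv t _).sub (huv' t _)) (hdV _) ?_ ?_ (hmeas _) t ?_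
      · rw [hu0, hu0', sub_self]
      · rw [hv0, hv0', sub_self]
      · obtain ⟨R, hR⟩ := h2.isCompact.isBounded.exists_norm_le
        obtain ⟨B, hB⟩ := h2.exists_bound_of_continuous h1.continuous
        obtain ⟨C, hC⟩ := hbound |t| R
        refine ⟨B * C, fun s hs => ?_⟩
        rw [← hp']
        refine (norm_integral_mul_le (hloc' s) hB (R := R) fun x hx => ?_).trans
          (mul_le_mul_of_nonneg_left (hC s hs) ((norm_nonneg _).trans (hB 0)))
        by_contra h0
        have := hR x (subset_tsupport _ h0)
        rw [Real.norm_eq_abs] at this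
        linarith
  ext1 t
  have h : 𝓕 (u t) = 𝓕 (u' t) := by
    refine ext_of_hasCompactSupport fun χ hχ => ?_
    have hae : g t =ᵐ[volume] g' t := by
      filter_upwards [hnull.ae_eq_zero t] with ξ hξ
      exact sub_eq_zero.1 hξ
    rw [((hg t).congr hae).2 χ hχ, (hg' t).2 χ hχ]
  have h1 : 𝓕⁻ (𝓕 (u t)) = u t := FourierTransform.fourierInv_fourier_eq _
  have h2 : 𝓕⁻ (𝓕 (u' t)) = u' t := FourierTransform.fourierInv_fourier_eq _
  rw [← h1, h, h2]

/-! ### A Paley–Wiener theorem for bounded Fourier transforms -/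

/-- A distribution vanishes on test functions supported off its support, by a partition of unity. -/
theorem apply_eq_zero_of_disjoint_dsupport (T : 𝓢'(ℝ, ℂ)) {χ : 𝓢(ℝ, ℂ)} (hχ : HasCompactSupport χ)
    (h : Disjoint (tsupport χ) (Distribution.dsupport (T : 𝓢(ℝ, ℂ) → ℂ))) : T χ = 0 := by
  have hx : ∀ x : tsupport χ, ∃ U : Set ℝ,
      Distribution.IsVanishingOn (T : 𝓢(ℝ, ℂ) → ℂ) U ∧ IsOpen U ∧ (x : ℝ) ∈ U := fun x =>
    (Distribution.notMem_dsupport_iff _).1 (Set.disjoint_left.1 h x.2)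
  choose U hUv hUo hUx using hx
  obtain ⟨t, ht⟩ := hχ.isCompact.elim_finite_subcover U hUo
    fun x hx => Set.mem_iUnion.2 ⟨⟨x, hx⟩, hUx _⟩
  obtain ⟨f, hf⟩ := SmoothPartitionOfUnity.exists_isSubordinate 𝓘(ℝ, ℝ) hχ.isCompact.isClosed
    (fun i : t => U i) (fun i => hUo i) (fun x hx => by simpa using ht hx)
  have hs : ∀ i, HasCompactSupport (fun x => ((f i x : ℝ) : ℂ) * χ x) := fun i => hχ.mul_left
  have hd : ∀ i, ContDiff ℝ ∞ (fun x => ((f i x : ℝ) : ℂ) * χ x) := fun i =>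
    (Complex.ofRealCLM.contDiff.comp (f i).contMDiff.contDiff).mul (χ.smooth ⊤)
  have hsum : χ = ∑ i, (hs i).toSchwartzMap (hd i) := by
    ext x
    rw [sum_apply]
    change χ x = ∑ i, ((f i x : ℝ) : ℂ) * χ x
    by_cases hx : χ x = 0
    · simp [hx]
    · have h1 := f.sum_eq_one (subset_tsupport _ hx)
      rw [finsum_eq_sum_of_fintype] at h1
      rw [← Finset.sum_mul, ← Complex.ofReal_sum, h1, Complex.ofReal_one, one_mul]
  rw [hsum, map_sum]
  refine Finset.sum_eq_zero fun i _ => hUv i _ ((closure_mono ?_).trans (hf i))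
  intro x hx
  change ((f i x : ℝ) : ℂ) * χ x ≠ 0 at hx
  simpa using left_ne_zero_of_mul hx

/-- The Fourier–Laplace transform of the restriction of `h` to `[-a, a]`. -/
def fourierLaplace (h : ℝ → ℂ) (a : ℝ) (z : ℂ) : ℂ :=
  ∫ x in Set.Icc (-a) a, Complex.exp (((-2 * Real.pi * x : ℝ) : ℂ) * Complex.I * z) * h x

theorem norm_exp_le_of_mem_Icc {a x : ℝ} (hx : x ∈ Set.Icc (-a) a) (z : ℂ) :
    ‖Complex.exp (((-2 * Real.pi * x : ℝ) : ℂ) * Complex.I * z)‖ ≤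
      Real.exp (2 * Real.pi * a * ‖z‖) := by
  rw [Complex.norm_exp]
  refine Real.exp_le_exp.2 ((Complex.re_le_norm _).trans ?_)
  rw [norm_mul, norm_mul, Complex.norm_I, mul_one, Complex.norm_real, norm_mul, norm_mul,
    Real.norm_of_nonneg Real.pi_pos.le, Real.norm_eq_abs x]
  have : |x| ≤ a := abs_le.2 hx
  norm_num
  gcongr

theorem differentiable_fourierLaplace {h : ℝ → ℂ} (hh : Continuous h) (a : ℝ) :
    Differentiable ℂ (fourierLaplace h a) := by
  intro z
  obtain ⟨H, hH⟩ := (isCompact_Icc (a := -a) (b := a)).exists_bound_of_continuousOn hh.continuousOn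
  have hcont : ∀ w : ℂ, Continuous
      (fun x : ℝ => Complex.exp (((-2 * Real.pi * x : ℝ) : ℂ) * Complex.I * w) * h x) := by
    intro w; fun_prop
  have hmem : ∀ᵐ x ∂volume.restrict (Set.Icc (-a) a), x ∈ Set.Icc (-a) a :=
    ae_restrict_mem measurableSet_Icc
  refine (hasDerivAt_integral_of_dominated_loc_of_deriv_le (𝕜 := ℂ) (s := Metric.ball z 1)
    (F' := fun w x => Complex.exp (((-2 * Real.pi * x : ℝ) : ℂ) * Complex.I * w) *
      (((-2 * Real.pi * x : ℝ) : ℂ) * Complex.I) * h x)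
    (bound := fun _ => Real.exp (2 * Real.pi * a * (‖z‖ + 1)) * (2 * Real.pi * a) * H)
    (Metric.ball_mem_nhds z one_pos)
    (Eventually.of_forall fun w => (hcont w).aestronglyMeasurable)
    (hcont z).continuousOn.integrableOn_Icc ?_ ?_ ?_ ?_).2.differentiableAt
  · exact Continuous.aestronglyMeasurable (by fun_prop)
  · filter_upwards [hmem] with x hx w hw
    have h1 := norm_exp_le_of_mem_Icc hx w
    have ha : |x| ≤ a := abs_le.2 hx
    have ha0 : 0 ≤ a := (abs_nonneg x).trans ha
    have hw' : ‖w‖ ≤ ‖z‖ + 1 := by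
      have : ‖w - z‖ < 1 := by simpa [dist_eq_norm] using hw
      have h2 := norm_add_le (w - z) z
      rw [sub_add_cancel] at h2
      linarith
    rw [norm_mul, norm_mul]
    refine mul_le_mul (mul_le_mul (h1.trans ?_) ?_ (norm_nonneg _) (Real.exp_pos _).le) (hH x hx)
      (norm_nonneg _) (by positivity)
    · exact Real.exp_le_exp.2 (mul_le_mul_of_nonneg_left hw' (by positivity))
    · rw [norm_mul, Complex.norm_I, mul_one, Complex.norm_real, norm_mul, norm_mul,
        Real.norm_of_nonneg Real.pi_pos.le, Real.norm_eq_abs x]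
      norm_num
      gcongr
  · exact integrable_const _
  · refine Eventually.of_forall fun x w _ => ?_
    exact ((((hasDerivAt_id w).const_mul (((-2 * Real.pi * x : ℝ) : ℂ) * Complex.I)).cexp).mul_const
      (h x)).congr_deriv (by simp)

theorem norm_fourierLaplace_le {h : ℝ → ℂ} {a H : ℝ} (ha : 0 ≤ a) (hH : ∀ x, ‖h x‖ ≤ H) (z : ℂ) :
    ‖fourierLaplace h a z‖ ≤ 2 * a * H * Real.exp (2 * Real.pi * a * ‖z‖) := by
  refine (norm_setIntegral_le_of_norm_le_const (C := Real.exp (2 * Real.pi * a * ‖z‖) * H)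
    measure_Icc_lt_top fun x hx => ?_).trans ?_
  · rw [norm_mul]
    exact mul_le_mul (norm_exp_le_of_mem_Icc hx z) (hH x) (norm_nonneg _) (Real.exp_pos _).le
  · rw [Real.volume_real_Icc_of_le (by linarith)]
    exact le_of_eq (by ring)

theorem fourierLaplace_ofReal {h : ℝ → ℂ} {a : ℝ} (hh : ∀ x, a < |x| → h x = 0) (ξ : ℝ) :
    fourierLaplace h a ξ = 𝓕 h ξ := by
  rw [Real.fourier_real_eq_integral_exp_smul, fourierLaplace,
    setIntegral_eq_integral_of_forall_compl_eq_zero]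
  · congr 1
    ext x
    rw [smul_eq_mul]
    congr 2
    push_cast
    ring
  · intro x hx
    rw [Set.mem_Icc, ← abs_le] at hx
    rw [hh x (not_le.1 hx), mul_zero]

theorem integrable_of_eq_zero_of_lt_abs {h : ℝ → ℂ} (hc : Continuous h) {a : ℝ}
    (hh : ∀ x, a < |x| → h x = 0) : Integrable h := by
  refine hc.integrable_of_hasCompactSupport
    (HasCompactSupport.intro (isCompact_Icc (a := -a) (b := a)) fun x hx => hh x ?_)
  rw [Set.mem_Icc, ← abs_le] at hx
  exact not_le.1 hx

theorem fourier_fourierInv_ae_eq {f : ℝ → ℂ} (hf : Integrable f)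
    (hf' : Integrable (𝓕⁻ f : ℝ → ℂ)) : (𝓕 (𝓕⁻ f : ℝ → ℂ) : ℝ → ℂ) =ᵐ[volume] f := by
  have hc : Continuous (𝓕 (𝓕⁻ f : ℝ → ℂ) : ℝ → ℂ) :=
    VectorFourier.fourierIntegral_continuous Real.continuous_fourierChar (by fun_prop) hf'
  refine ae_eq_of_integral_contDiff_smul_eq hc.locallyIntegrable hf.locallyIntegrable
    fun b hb hbc => ?_
  have h1 : HasCompactSupport (fun x => (b x : ℂ)) :=
    hbc.comp_left (g := fun r : ℝ => (r : ℂ)) Complex.ofReal_zero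
  have h2 : ContDiff ℝ ∞ (fun x => (b x : ℂ)) := Complex.ofRealCLM.contDiff.comp hb
  let χ := h1.toSchwartzMap h2
  have hχ : ∀ x, (b x : ℂ) = χ x := fun x => rfl
  have hχi : Integrable (𝓕 (χ : ℝ → ℂ) : ℝ → ℂ) := by
    rw [← fourier_coe]
    exact (𝓕 χ).integrable
  have hinv : (𝓕⁻ (𝓕 (χ : ℝ → ℂ) : ℝ → ℂ) : ℝ → ℂ) = χ := by
    rw [← fourier_coe, ← fourierInv_coe, FourierTransform.fourierInv_fourier_eq]
  have h3 := integral_fourier_mul_eq_of_integrable hf' χ.integrable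
  have h4 := integral_fourierInv_mul_eq_of_integrable hf hχi
  rw [hinv] at h4
  simp only [Complex.real_smul, hχ]
  simp_rw [mul_comm (χ _)]
  exact h3.trans h4

theorem eq_of_ae_eq_ofReal {f g : ℂ → ℂ} (hf : Differentiable ℂ f) (hg : Differentiable ℂ g)
    (h : ∀ᵐ x : ℝ, f x = g x) : f = g := by
  have h1 : (fun x : ℝ => f x) = fun x : ℝ => g x :=
    Continuous.ae_eq_iff_eq volume (hf.continuous.comp Complex.continuous_ofReal)
      (hg.continuous.comp Complex.continuous_ofReal) |>.1 h
  have h2 : Tendsto (fun x : ℝ => (x : ℂ)) (𝓝[≠] 0) (𝓝[≠] ((0 : ℝ) : ℂ)) :=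
    (Complex.continuous_ofReal.tendsto 0).mono_left nhdsWithin_le_nhds |> fun h =>
      tendsto_nhdsWithin_iff.2 ⟨h, by
        filter_upwards [self_mem_nhdsWithin] with x hx
        simpa using hx⟩
  exact AnalyticOnNhd.eq_of_frequently_eq (fun z _ => hf.analyticAt z)
    (fun z _ => hg.analyticAt z)
    (h2.frequently (Frequently.of_forall fun x => congrFun h1 x))

theorem contDiff_mollifier (n : ℕ) : ContDiff ℝ ∞
    (fun x : ℝ => ((((n : ℝ) + 1) * bump.normed volume (((n : ℝ) + 1) * x) : ℝ) : ℂ)) :=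
  Complex.ofRealCLM.contDiff.comp
    (contDiff_const.mul (bump.contDiff_normed.comp (contDiff_const.mul contDiff_id)))

theorem bump_normed_eq_zero {x : ℝ} (hx : 2 ≤ |x|) : bump.normed volume x = 0 := by
  have h1 : x ∉ Function.support (bump.normed volume) := by
    rw [bump.support_normed_eq, mem_ball_zero_iff, Real.norm_eq_abs]
    exact not_lt.2 hx
  simpa using h1

theorem mollifier_eq_zero (n : ℕ) {x : ℝ} (hx : 2 ≤ |x|) :
    ((((n : ℝ) + 1) * bump.normed volume (((n : ℝ) + 1) * x) : ℝ) : ℂ) = 0 := by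
  rw [bump_normed_eq_zero, mul_zero, Complex.ofReal_zero]
  rw [abs_mul, abs_of_pos (by positivity)]
  nlinarith [n.cast_nonneg (α := ℝ), abs_nonneg x]

/-- The approximate identity `x ↦ (n + 1) ρ ((n + 1) x)`. -/
def mollifier (n : ℕ) : 𝓢(ℝ, ℂ) :=
  (HasCompactSupport.intro (isCompact_Icc (a := (-2 : ℝ)) (b := 2)) fun x hx =>
    mollifier_eq_zero n (by
      rw [Set.mem_Icc, ← abs_le] at hx
      exact (not_le.1 hx).le)).toSchwartzMap (contDiff_mollifier n)

theorem mollifier_apply (n : ℕ) (x : ℝ) :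
    mollifier n x = ((((n : ℝ) + 1) * bump.normed volume (((n : ℝ) + 1) * x) : ℝ) : ℂ) := rfl

theorem fourier_mollifier (n : ℕ) (ξ : ℝ) :
    𝓕 (mollifier n) ξ = 𝓕 (mollifier 0) (ξ / ((n : ℝ) + 1)) := by
  have hn : (0 : ℝ) < (n : ℝ) + 1 := by positivity
  have h := Measure.integral_comp_mul_left (fun y : ℝ =>
    Complex.exp (↑(-2 * Real.pi * y * (ξ / ((n : ℝ) + 1))) * Complex.I) •
      ((bump.normed volume y : ℝ) : ℂ)) ((n : ℝ) + 1)
  rw [abs_of_pos (inv_pos.2 hn)] at h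
  rw [fourier_coe, fourier_coe, Real.fourier_real_eq_integral_exp_smul,
    Real.fourier_real_eq_integral_exp_smul]
  simp only [mollifier_apply]
  have h' : ∀ I J : ℂ, I = ((n : ℝ) + 1)⁻¹ • J → (((n : ℝ) + 1 : ℝ) : ℂ) * I = J := by
    rintro I J rfl
    rw [Complex.real_smul, ← mul_assoc, ← Complex.ofReal_mul, mul_inv_cancel₀ hn.ne']
    simp
  have h2 := h' _ _ h
  rw [← integral_const_mul] at h2
  refine (integral_congr_ae (Eventually.of_forall fun x => ?_)).trans
    (h2.trans (integral_congr_ae (Eventually.of_forall fun x => ?_)))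
  · have : -2 * Real.pi * (((n : ℝ) + 1) * x) * (ξ / ((n : ℝ) + 1)) = -2 * Real.pi * x * ξ := by
      field_simp
    simp only [smul_eq_mul, this]
    push_cast
    ring
  · simp

theorem integral_norm_fourier_mollifier (n : ℕ) :
    ∫ ξ, ‖𝓕 (mollifier n) ξ‖ = ((n : ℝ) + 1) * ∫ ξ, ‖𝓕 (mollifier 0) ξ‖ := by
  simp_rw [fourier_mollifier n]
  rw [Measure.integral_comp_div (fun ξ : ℝ => ‖𝓕 (mollifier 0) ξ‖), smul_eq_mul,
    abs_of_pos (by positivity)]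

/-- A tempered distribution of compact support with bounded Fourier transform `m`: the function `m`
extends to an entire function of exponential type. The functions `m · ρ̂ₙ`, where `ρₙ` is the
mollifier of width `1 / n`, are Fourier transforms of continuous functions of compact support; they
extend to entire functions, which are divided by `ρ̂ₙ` on a disc of radius proportional to `n` on
which `ρ̂ₙ` is bounded away from zero. -/
theorem exists_entire_of_compactSupport {T : 𝓢'(ℝ, ℂ)} {m : ℝ → ℂ} {hm : IsTempered m} {B : ℝ}
    (hB0 : 0 ≤ B) (hB : ∀ ξ, ‖m ξ‖ ≤ B) (hT : 𝓕 T = regDist m hm) (hc : CompactSupport T) :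
    ∃ M : ℂ → ℂ, Differentiable ℂ M ∧
      (∃ K b : ℝ, 0 ≤ K ∧ 0 ≤ b ∧ ∀ z, ‖M z‖ ≤ K * Real.exp (b * ‖z‖)) ∧
      ∀ᵐ ξ : ℝ, M ξ = m ξ := by
  obtain ⟨A, hA0, hA⟩ : ∃ A : ℝ, 0 ≤ A ∧
      ∀ x ∈ Distribution.dsupport (T : 𝓢(ℝ, ℂ) → ℂ), |x| ≤ A := by
    obtain ⟨A, hA⟩ := hc.isBounded.exists_norm_le
    exact ⟨|A|, abs_nonneg _, fun x hx => (hA x hx).trans (le_abs_self A)⟩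
  set L : ℝ := ∫ ξ, ‖𝓕 (mollifier 0) ξ‖ with hL
  have hL0 : 0 ≤ L := integral_nonneg fun _ => norm_nonneg _
  let h : ℕ → ℝ → ℂ := fun n => 𝓕⁻ (fun ξ => 𝓕 (mollifier n) ξ * m ξ)
  have hi : ∀ n, Integrable (fun ξ => 𝓕 (mollifier n) ξ * m ξ) := fun n => hm.integrable_mul _
  have hcont : ∀ n, Continuous (h n) := fun n => continuous_fourierInv_of_integrable (hi n)
  have hbound : ∀ n x, ‖h n x‖ ≤ B * (((n : ℝ) + 1) * L) := by
    intro n x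
    refine (VectorFourier.norm_fourierIntegral_le_integral_norm _ _ _ _ x).trans ?_
    rw [hL, ← integral_norm_fourier_mollifier, ← integral_const_mul]
    refine integral_mono (hi n).norm ((𝓕 (mollifier n)).integrable.norm.const_mul B) fun ξ => ?_
    simp only [norm_mul]
    rw [mul_comm]
    gcongr
    exact hB ξ
  have hzero : ∀ n x, A + 2 < |x| → h n x = 0 := by
    intro n x hx
    have h1 : conv T (mollifier n) x = h n x := conv_eq_of_isTempered hm hT _ x
    rw [← h1, conv]
    have hsupp : tsupport (reflectAt (mollifier n) x) ⊆ Metric.closedBall x 2 := by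
      refine closure_minimal (fun y hy => ?_) Metric.isClosed_closedBall
      by_contra hy'
      rw [Metric.mem_closedBall, Real.dist_eq, abs_sub_comm, not_le] at hy'
      rw [Function.mem_support, reflectAt_apply, mollifier_apply, mollifier_eq_zero n hy'.le] at hy
      exact hy rfl
    refine apply_eq_zero_of_disjoint_dsupport T
      (HasCompactSupport.of_support_subset_isCompact (isCompact_closedBall x 2)
        ((subset_tsupport _).trans hsupp)) (Set.disjoint_left.2 fun y hy hy' => ?_)
    have h2 := hA y hy'
    have h3 := hsupp hy
    rw [Metric.mem_closedBall, Real.dist_eq, abs_sub_comm] at h3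
    have h4 := abs_sub_abs_le_abs_sub x y
    linarith
  let P : ℂ → ℂ := fourierLaplace (mollifier 0) 2
  have hP : Differentiable ℂ P := differentiable_fourierLaplace (mollifier 0).continuous 2
  have hPreal : ∀ ξ : ℝ, P ξ = 𝓕 (mollifier 0) ξ := fun ξ => by
    rw [fourier_coe]
    exact fourierLaplace_ofReal (fun x hx => mollifier_eq_zero 0 hx.le) ξ
  have hP0 : P 0 = 1 := by
    have h1 := hPreal 0
    rw [Complex.ofReal_zero] at h1
    rw [h1, fourier_coe, Real.fourier_real_eq_integral_exp_smul]
    have : ∀ v : ℝ, Complex.exp (↑(-2 * Real.pi * v * 0) * Complex.I) • mollifier 0 v =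
        ((bump.normed volume v : ℝ) : ℂ) := fun v => by simp [mollifier_apply]
    simp_rw [this]
    rw [integral_complex_ofReal, bump.integral_normed, Complex.ofReal_one]
  obtain ⟨r, hr0, hr⟩ : ∃ r > 0, ∀ z, ‖z‖ < r → 1 / 2 ≤ ‖P z‖ := by
    have h1 : Tendsto (fun z => ‖P z‖) (𝓝 0) (𝓝 1) := by
      have := (hP.continuous.norm).tendsto 0
      rwa [hP0, norm_one] at this
    obtain ⟨r, hr0, hr⟩ := Metric.eventually_nhds_iff.1
      (h1.eventually (lt_mem_nhds (by norm_num : (1 / 2 : ℝ) < 1)))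
    exact ⟨r, hr0, fun z hz => (hr (by simpa using hz)).le⟩
  let H : ℕ → ℂ → ℂ := fun n => fourierLaplace (h n) (A + 2)
  let Q : ℕ → ℂ → ℂ := fun n z => P (z / ((n : ℂ) + 1))
  have hHd : ∀ n, Differentiable ℂ (H n) := fun n => differentiable_fourierLaplace (hcont n) _
  have hQd : ∀ n, Differentiable ℂ (Q n) := fun n => hP.comp (differentiable_id.div_const _)
  have hHreal : ∀ n, ∀ᵐ ξ : ℝ, H n ξ = Q n ξ * m ξ := by
    intro n
    filter_upwards [fourier_fourierInv_ae_eq (hi n)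
      (integrable_of_eq_zero_of_lt_abs (hcont n) (hzero n))] with ξ hξ
    have h1 : H n ξ = 𝓕 (h n) ξ := fourierLaplace_ofReal (hzero n) ξ
    have h2 : Q n ξ = 𝓕 (mollifier n) ξ := by
      rw [fourier_mollifier, ← hPreal]
      simp [Q]
    rw [h1, h2]
    exact hξ
  have hcross : ∀ n k z, H n z * Q k z = H k z * Q n z := by
    intro n k
    refine congrFun (eq_of_ae_eq_ofReal ((hHd n).mul (hQd k)) ((hHd k).mul (hQd n)) ?_)
    filter_upwards [hHreal n, hHreal k] with ξ h1 h2
    simp only [h1, h2]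
    ring
  have hQ : ∀ (n : ℕ) (z : ℂ), ‖z‖ < r * ((n : ℝ) + 1) → 1 / 2 ≤ ‖Q n z‖ := by
    intro n z hz
    refine hr _ ?_
    have : ‖(n : ℂ) + 1‖ = (n : ℝ) + 1 := by
      have := Complex.norm_natCast (n + 1)
      push_cast at this
      exact this
    rw [norm_div, this, div_lt_iff₀ (by positivity)]
    exact hz
  have hQ0 : ∀ (n : ℕ) (z : ℂ), ‖z‖ < r * ((n : ℝ) + 1) → Q n z ≠ 0 := fun n z hz h0 => by
    have := hQ n z hz
    rw [h0, norm_zero] at this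
    norm_num at this
  let N : ℂ → ℕ := fun z => ⌈‖z‖ / r⌉₊
  have hN : ∀ z, ‖z‖ < r * ((N z : ℝ) + 1) := fun z => by
    have h1 := Nat.le_ceil (‖z‖ / r)
    rw [← div_lt_iff₀' hr0]
    exact lt_of_le_of_lt h1 (lt_add_one _)
  have hM : ∀ (n : ℕ) (z : ℂ), ‖z‖ < r * ((n : ℝ) + 1) →
      H (N z) z / Q (N z) z = H n z / Q n z := by
    intro n z hz
    rw [div_eq_div_iff (hQ0 _ _ (hN z)) (hQ0 n z hz)]
    exact hcross _ _ z
  refine ⟨fun z => H (N z) z / Q (N z) z, fun z => ?_,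
    ⟨2 * (2 * (A + 2) * (B * L)) * 2, 2 * Real.pi * (A + 2) + r⁻¹, by positivity, by positivity,
      fun z => ?_⟩, ?_⟩
  · have hev : (fun w => H (N w) w / Q (N w) w) =ᶠ[𝓝 z] fun w => H (N z) w / Q (N z) w := by
      filter_upwards [(isOpen_lt continuous_norm continuous_const).mem_nhds (hN z)] with w hw
      exact hM (N z) w hw
    exact ((hHd _ z).div (hQd _ z) (hQ0 _ _ (hN z))).congr_of_eventuallyEq hev
  · have h1 := hQ (N z) z (hN z)
    have h2 := norm_fourierLaplace_le (by positivity : 0 ≤ A + 2) (hbound (N z)) z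
    have h3 : (N z : ℝ) + 1 ≤ 2 * Real.exp (r⁻¹ * ‖z‖) := by
      have h4 := (Nat.ceil_lt_add_one (by positivity : 0 ≤ ‖z‖ / r)).le
      have h5 := Real.add_one_le_exp (r⁻¹ * ‖z‖)
      have h6 : 0 ≤ r⁻¹ * ‖z‖ := by positivity
      have h7 : ‖z‖ / r = r⁻¹ * ‖z‖ := div_eq_inv_mul _ _
      change (N z : ℝ) ≤ _ at h4
      linarith
    rw [norm_div, div_le_iff₀ (by linarith)]
    calc ‖H (N z) z‖
        ≤ 2 * (A + 2) * (B * (((N z : ℝ) + 1) * L)) *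
            Real.exp (2 * Real.pi * (A + 2) * ‖z‖) := h2
      _ ≤ 2 * (A + 2) * (B * ((2 * Real.exp (r⁻¹ * ‖z‖)) * L)) *
            Real.exp (2 * Real.pi * (A + 2) * ‖z‖) := by gcongr
      _ = (2 * (2 * (A + 2) * (B * L)) * 2 *
            Real.exp ((2 * Real.pi * (A + 2) + r⁻¹) * ‖z‖)) * (1 / 2) := by
          rw [add_mul, Real.exp_add]; ring
      _ ≤ _ := by gcongr
  · filter_upwards [ae_all_iff.2 hHreal] with ξ hξ
    rw [hξ, mul_div_cancel_left₀ _ (hQ0 _ _ (hN _))]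

/-! ### Entire functions related by the Pythagorean identity -/

/-- The entire function `w ↦ cos √w`, given by its power series. -/
def cosSqrt (w : ℂ) : ℂ := ∑' n : ℕ, (-1) ^ n * w ^ n / ((2 * n).factorial : ℂ)

theorem cosSqrt_sq (θ : ℂ) : cosSqrt (θ ^ 2) = Complex.cos θ := by
  rw [← (Complex.hasSum_cos θ).tsum_eq, cosSqrt]
  simp_rw [pow_mul]

theorem differentiable_cosSqrt : Differentiable ℂ cosSqrt := by
  intro w
  have h : DifferentiableOn ℂ cosSqrt (Metric.ball 0 (‖w‖ + 1)) := by
    refine Complex.differentiableOn_tsum_of_summable_norm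
      (Real.summable_pow_div_factorial (‖w‖ + 1)) (fun n => by fun_prop) Metric.isOpen_ball
      fun n z hz => ?_
    rw [mem_ball_zero_iff] at hz
    rw [norm_div, norm_mul, norm_pow, norm_pow, norm_neg, norm_one, one_pow, one_mul,
      Complex.norm_natCast]
    have h1 : (n.factorial : ℝ) ≤ (2 * n).factorial :=
      Nat.cast_le.2 (Nat.factorial_le (by omega))
    have h2 : (0 : ℝ) < n.factorial := Nat.cast_pos.2 n.factorial_pos
    gcongr
  exact h.differentiableAt (Metric.isOpen_ball.mem_nhds (by simp))

/-- `|cos θ|` grows like `exp |Im θ| / 2`. -/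
theorem exp_abs_im_le (θ : ℂ) : Real.exp |θ.im| ≤ 2 * ‖Complex.cos θ‖ + 1 := by
  have h1 : ‖Complex.exp (θ * Complex.I)‖ = Real.exp (-θ.im) := by simp [Complex.norm_exp]
  have h2 : ‖Complex.exp (-θ * Complex.I)‖ = Real.exp θ.im := by simp [Complex.norm_exp]
  have h3 : 2 * ‖Complex.cos θ‖ =
      ‖Complex.exp (θ * Complex.I) + Complex.exp (-θ * Complex.I)‖ := by
    rw [← Complex.two_cos, norm_mul, Complex.norm_ofNat]
  rw [h3]
  rcases abs_cases θ.im with ⟨h, h'⟩ | ⟨h, h'⟩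
  · have h4 := norm_sub_le_norm_add (Complex.exp (-θ * Complex.I)) (Complex.exp (θ * Complex.I))
    have h5 : Real.exp (-θ.im) ≤ 1 := Real.exp_le_one_iff.2 (by linarith)
    rw [add_comm, h1, h2] at h4
    rw [h]
    linarith
  · have h4 := norm_sub_le_norm_add (Complex.exp (θ * Complex.I)) (Complex.exp (-θ * Complex.I))
    have h5 : Real.exp θ.im ≤ 1 := Real.exp_le_one_iff.2 h'.le
    rw [h1, h2] at h4
    rw [h]
    linarith

/-- A bound on `cos θ` of exponential type bounds `Re θ²` from below by a quadratic. -/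
theorem neg_sq_le_re_of_norm_cosSqrt_le {w : ℂ} {K s : ℝ} (hK : 0 ≤ K) (hs : 0 ≤ s)
    (h : ‖cosSqrt w‖ ≤ K * Real.exp s) : -(s + Real.log (2 * K + 1)) ^ 2 ≤ w.re := by
  obtain ⟨θ, rfl⟩ := IsSquare.exists_sq w (IsAlgClosed.exists_pow_nat_eq w two_pos |>.imp
    fun z hz => by rw [← hz, sq])
  rw [cosSqrt_sq] at h
  have h1 := exp_abs_im_le θ
  have h2 : Real.exp |θ.im| ≤ Real.exp (s + Real.log (2 * K + 1)) := by
    rw [Real.exp_add, Real.exp_log (by positivity)]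
    nlinarith [Real.one_le_exp hs]
  have h3 := Real.exp_le_exp.1 h2
  have h4 : θ.im ^ 2 ≤ (s + Real.log (2 * K + 1)) ^ 2 := by
    rw [← sq_abs]
    gcongr
  rw [sq θ, Complex.mul_re]
  nlinarith [sq_nonneg θ.re]

/-- A meromorphic function whose real part is bounded from below has no poles, because near a pole
it takes all sufficiently large values. -/
theorem meromorphicOrderAt_nonneg_of_le_re {F : ℂ → ℂ} {z₀ : ℂ} {D : ℝ} (hF : MeromorphicAt F z₀)
    (h : ∀ᶠ z in 𝓝[≠] z₀, D ≤ (F z).re) : 0 ≤ meromorphicOrderAt F z₀ := by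
  by_contra hneg
  rw [not_le] at hneg
  have hpos : 0 < meromorphicOrderAt F⁻¹ z₀ := by
    rw [meromorphicOrderAt_inv]
    cases hF' : meromorphicOrderAt F z₀ with
    | top => simp [hF'] at hneg
    | coe n =>
      rw [hF'] at hneg
      have hn : n < 0 := by exact_mod_cast hneg
      have : (0 : ℤ) < -n := by omega
      exact_mod_cast this
  set g := toMeromorphicNFAt F⁻¹ z₀ with hg
  have hga : AnalyticAt ℂ g z₀ :=
    hF.inv.meromorphicOrderAt_nonneg_iff_analyticAt_toMeromorphicNFAt.1 hpos.le
  have hg0 : g z₀ = 0 := toMeromorphicNFAt_of_meromorphicOrderAt_ne_zero hpos.ne'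
  have hgF : F⁻¹ =ᶠ[𝓝[≠] z₀] g := hF.inv.eq_nhdsNE_toMeromorphicNFAt
  have hne : ∀ᶠ z in 𝓝[≠] z₀, F z ≠ 0 := by
    have := tendsto_cobounded_of_meromorphicOrderAt_neg hneg
    exact this.eventually (Bornology.eventually_ne_cobounded 0)
  -- By the open mapping theorem `1 / F` takes the values `-1 / r` for all large `r`.
  rcases hga.eventually_constant_or_nhds_le_map_nhds with hc | hm
  · obtain ⟨z, h1, h2, h3⟩ := ((hc.filter_mono nhdsWithin_le_nhds).and (hgF.and hne)).exists
    rw [hg0, ← h2] at h1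
    exact h3 (inv_eq_zero.1 h1)
  · have hev : ∀ᶠ z in 𝓝[≠] z₀, D ≤ (g z)⁻¹.re := by
      filter_upwards [h, hgF] with z h1 h2
      rw [← h2]
      simpa using h1
    rw [eventually_nhdsWithin_iff] at hev
    have hev' : ∀ᶠ w in 𝓝 (0 : ℂ), w ≠ 0 → D ≤ w⁻¹.re := by
      rw [← hg0]
      have himage : g '' {z | z ∈ ({z₀}ᶜ : Set ℂ) → D ≤ (g z)⁻¹.re} ∈ 𝓝 (g z₀) :=
        hm (mem_map.2 (mem_of_superset hev (Set.subset_preimage_image _ _)))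
      filter_upwards [himage] with _ ⟨z, hz, hzw⟩ hw
      rw [← hzw] at hw ⊢
      exact hz fun h0 => hw (by rw [h0])
    have hlim : Tendsto (fun r : ℝ => -((r⁻¹ : ℝ) : ℂ)) atTop (𝓝 0) := by
      have := (Complex.continuous_ofReal.tendsto 0).comp tendsto_inv_atTop_zero
      simpa using this.neg
    obtain ⟨r, h1, h2, h3⟩ := ((hlim.eventually hev').and
      ((eventually_gt_atTop 0).and (eventually_gt_atTop (-D)))).exists
    have h4 := h1 (neg_ne_zero.2 (Complex.ofReal_ne_zero.2 (inv_pos.2 h2).ne'))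
    rw [inv_neg, ← Complex.ofReal_inv, inv_inv, Complex.neg_re, Complex.ofReal_re] at h4
    linarith

theorem countable_zeros {S : ℂ → ℂ} (hS : Differentiable ℂ S) (h : ∃ z, S z ≠ 0) :
    {z | S z = 0}.Countable := by
  obtain ⟨z, hz⟩ := h
  refine (HereditarilyLindelofSpace.isLindelof _).countable_of_isDiscrete ?_
  rw [← Set.inter_univ {z | S z = 0}]
  refine isDiscrete_of_codiscreteWithin ?_
  have h1 : AnalyticOnNhd ℂ S Set.univ := fun z _ => hS.analyticAt z
  exact h1.preimage_zero_mem_codiscrete hz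

/-- An entire function with real part bounded from above by a quadratic is a quadratic polynomial,
by the Borel–Carathéodory theorem and Cauchy's estimates. -/
theorem exists_quadratic_of_re_le {f : ℂ → ℂ} (hf : Differentiable ℂ f) {b l : ℝ} (hb : 0 ≤ b)
    (hl : 0 ≤ l) (h : ∀ z, (f z).re ≤ (b * ‖z‖ + l) ^ 2) :
    ∃ a₂ a₁ a₀ : ℂ, ∀ z, f z = a₂ * z ^ 2 + a₁ * z + a₀ := by
  have hgrowth : ∀ r : ℝ, 1 ≤ r → ∀ z ∈ Metric.sphere (0 : ℂ) r,
      ‖f z‖ ≤ (2 * ((2 * b + l) ^ 2 + 1) + 3 * ‖f 0‖) * r ^ 2 := by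
    intro r hr z hz
    rw [mem_sphere_zero_iff_norm] at hz
    have hr0 : 0 < r := by linarith
    -- The bound on the real part is used on the disc of twice the radius.
    have h1 := Complex.borelCaratheodory (f := f) (M := (2 * b + l) ^ 2 * r ^ 2 + 1) (R := 2 * r)
      (z := z) (by positivity) hf.differentiableOn ?_ (by positivity)
      (by rw [mem_ball_zero_iff, hz]; linarith)
    · rw [hz] at h1
      have e1 : 2 * r - r = r := by ring
      rw [e1, mul_div_assoc, div_self hr0.ne', mul_one] at h1
      have e2 : ‖f 0‖ * (2 * r + r) / r = 3 * ‖f 0‖ := by field_simp; ring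
      rw [e2] at h1
      have hr2 : 1 ≤ r ^ 2 := one_le_pow₀ hr
      nlinarith [norm_nonneg (f 0)]
    · intro w hw
      rw [mem_ball_zero_iff] at hw
      refine (h w).trans ?_
      have : b * ‖w‖ + l ≤ (2 * b + l) * r := by nlinarith
      have h2 : (b * ‖w‖ + l) ^ 2 ≤ ((2 * b + l) * r) ^ 2 := by gcongr
      rw [mul_pow] at h2
      linarith
  have hder : ∀ n : ℕ, iteratedDeriv (n + 3) f 0 = 0 := by
    intro n
    set D := 2 * ((2 * b + l) ^ 2 + 1) + 3 * ‖f 0‖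
    have hD : 0 ≤ D := by positivity
    have hle : ∀ᶠ r : ℝ in atTop,
        ‖iteratedDeriv (n + 3) f 0‖ ≤ ((n + 3).factorial * D) * r⁻¹ := by
      filter_upwards [eventually_ge_atTop 1] with r hr
      have hr0 : 0 < r := by linarith
      refine (Complex.norm_iteratedDeriv_le_of_forall_mem_sphere_norm_le (n + 3) hr0
        hf.diffContOnCl (hgrowth r hr)).trans ?_
      rw [← mul_assoc, mul_div_assoc]
      refine mul_le_mul_of_nonneg_left ?_ (by positivity)
      rw [div_le_iff₀ (by positivity), inv_mul_eq_div, le_div_iff₀ hr0]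
      calc r ^ 2 * r = r ^ 3 := by ring
        _ ≤ r ^ (n + 3) := pow_le_pow_right₀ hr (by omega)
    have hlim : Tendsto (fun r : ℝ => ((n + 3).factorial * D) * r⁻¹) atTop (𝓝 0) := by
      simpa using tendsto_inv_atTop_zero.const_mul (((n + 3).factorial : ℝ) * D)
    exact norm_le_zero_iff.1 (ge_of_tendsto hlim hle)
  refine ⟨((2 : ℕ).factorial : ℂ)⁻¹ * iteratedDeriv 2 f 0,
    ((1 : ℕ).factorial : ℂ)⁻¹ * iteratedDeriv 1 f 0,
    ((0 : ℕ).factorial : ℂ)⁻¹ * iteratedDeriv 0 f 0, fun z => ?_⟩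
  rw [← Complex.taylorSeries_eq_of_entire' 0 z hf, tsum_eq_sum (s := Finset.range 3)]
  · simp only [Finset.sum_range_succ, Finset.sum_range_zero, sub_zero]
    ring
  · intro n hn
    obtain ⟨k, rfl⟩ : ∃ k, n = k + 3 := ⟨n - 3, by rw [Finset.mem_range] at hn; omega⟩
    rw [hder, mul_zero, zero_mul]

/-- If `cos (t √φ)` and `sin (t √φ) / √φ` extend to entire functions `C`, `S`, the first one of
exponential type, then `φ` is a quadratic polynomial. The function `(1 - C²) / S²` extends `φ`; it
is meromorphic, and `C = cos (t √φ)` bounds its real part from below, which excludes poles and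
growth beyond the second order. -/
theorem exists_quadratic_of_entire {φ : ℝ → ℂ} {C S : ℂ → ℂ} {t K b : ℝ} (ht : 0 < t)
    (hC : Differentiable ℂ C) (hS : Differentiable ℂ S) (hS0 : ∃ z, S z ≠ 0) (hK : 0 ≤ K)
    (hb : 0 ≤ b) (hbound : ∀ z, ‖C z‖ ≤ K * Real.exp (b * ‖z‖))
    (hpyth : ∀ᵐ x : ℝ, C x ^ 2 + φ x * S x ^ 2 = 1)
    (hcos : ∀ᵐ x : ℝ, C x = cosSqrt ((t : ℂ) ^ 2 * φ x)) :
    ∃ a₂ a₁ a₀ : ℂ, ∀ᵐ x : ℝ, φ x = a₂ * (x : ℂ) ^ 2 + a₁ * x + a₀ := by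
  have ht0 : (t : ℂ) ≠ 0 := Complex.ofReal_ne_zero.2 ht.ne'
  have hcount := countable_zeros hS hS0
  let F : ℂ → ℂ := fun z => (t : ℂ) ^ 2 * ((1 - C z ^ 2) / S z ^ 2)
  have hSae : ∀ᵐ x : ℝ, S x ≠ 0 := by
    have := hcount.preimage Complex.ofReal_injective
    exact compl_mem_ae_iff.2 (this.measure_zero volume)
  have hFφ : ∀ᵐ x : ℝ, F x = (t : ℂ) ^ 2 * φ x := by
    filter_upwards [hSae, hpyth] with x h1 h2
    simp only [F]
    rw [← h2, add_sub_cancel_left, mul_div_cancel_right₀ _ (pow_ne_zero 2 h1)]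
  have hFU : AnalyticOnNhd ℂ F {z | S z = 0}ᶜ := fun z hz =>
    analyticAt_const.mul ((analyticAt_const.sub ((hC.analyticAt z).pow 2)).div
      ((hS.analyticAt z).pow 2) (pow_ne_zero 2 hz))
  -- The zeros of `S` are countable, so their complement is connected and the relation
  -- `C = cos (t √φ)` propagates from the real line.
  have hCF : Set.EqOn C (fun z => cosSqrt (F z)) {z | S z = 0}ᶜ := by
    obtain ⟨x₀, hx₀⟩ := hSae.exists
    refine AnalyticOnNhd.eqOn_of_preconnected_of_frequently_eq (fun z _ => hC.analyticAt z)
      (fun z hz => (differentiable_cosSqrt.analyticAt _).comp (hFU z hz))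
      (hcount.isConnected_compl_of_one_lt_rank (by simp)).isPreconnected hx₀ ?_
    have hd : Dense {x : ℝ | C x = cosSqrt (F x) ∧ x ≠ x₀} := by
      refine Measure.dense_of_ae (μ := volume) ?_
      filter_upwards [hFφ, hcos, Measure.ae_ne volume x₀] with x h1 h2 h3
      exact ⟨by rw [h1, h2], h3⟩
    have hfr := mem_closure_iff_frequently.1 (hd x₀)
    rw [frequently_nhdsWithin_iff]
    refine (Complex.continuous_ofReal.tendsto x₀).frequently (hfr.mono fun x hx => ?_)
    exact ⟨hx.1, by simpa using hx.2⟩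
  set l := Real.log (2 * K + 1)
  have hl : 0 ≤ l := Real.log_nonneg (by linarith)
  have hre : ∀ z, S z ≠ 0 → -(b * ‖z‖ + l) ^ 2 ≤ (F z).re := fun z hz => by
    refine neg_sq_le_re_of_norm_cosSqrt_le hK (by positivity) ?_
    have := hCF hz
    beta_reduce at this
    rw [← this]
    exact hbound z
  have hmer : MeromorphicOn F Set.univ := fun z _ =>
    (MeromorphicAt.const _ z).mul (((MeromorphicAt.const _ z).sub
      ((hC.analyticAt z).meromorphicAt.pow 2)).div ((hS.analyticAt z).meromorphicAt.pow 2))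
  have hSne : ∀ z, ∀ᶠ w in 𝓝[≠] z, S w ≠ 0 := fun z => by
    obtain ⟨z₁, hz₁⟩ := hS0
    have h1 : AnalyticOnNhd ℂ S Set.univ := fun z _ => hS.analyticAt z
    have h2 := h1.preimage_zero_mem_codiscrete hz₁
    rw [mem_codiscrete] at h2
    have h3 := disjoint_principal_right.1 (h2 z)
    filter_upwards [h3] with w hw
    simpa using hw
  set G := toMeromorphicNFOn F Set.univ with hG
  have hGF : ∀ z, G =ᶠ[𝓝[≠] z] F := fun z => hmer.toMeromorphicNFOn_eq_self_on_nhdsNE trivial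
  have hGa : ∀ z, AnalyticAt ℂ G z := fun z => by
    rw [← (meromorphicNFOn_toMeromorphicNFOn F Set.univ
      (Set.mem_univ z)).meromorphicOrderAt_nonneg_iff_analyticAt,
      meromorphicOrderAt_toMeromorphicNFOn hmer (Set.mem_univ z)]
    refine meromorphicOrderAt_nonneg_of_le_re (D := -(b * (‖z‖ + 1) + l) ^ 2) (hmer z trivial) ?_
    have hlt : ∀ᶠ w in 𝓝[≠] z, ‖w‖ < ‖z‖ + 1 :=
      (continuous_norm.continuousAt.eventually (gt_mem_nhds (lt_add_one _))).filter_mono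
        nhdsWithin_le_nhds
    filter_upwards [hSne z, hlt] with w h1 h2
    refine le_trans ?_ (hre w h1)
    have : (b * ‖w‖ + l) ^ 2 ≤ (b * (‖z‖ + 1) + l) ^ 2 := by gcongr
    linarith
  have hGd : Differentiable ℂ G := fun z => (hGa z).differentiableAt
  have hGU : ∀ z, S z ≠ 0 → G z = F z := fun z hz => by
    have h1 := (hFU z hz).continuousAt
    have h2 := (hGa z).continuousAt
    exact ((h2.eventuallyEq_nhds_iff_eventuallyEq_nhdsNE h1).1 (hGF z)).eq_of_nhds
  obtain ⟨a₂, a₁, a₀, ha⟩ := exists_quadratic_of_re_le (f := fun z => -G z) hGd.neg hb hl (by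
    have hcl : IsClosed {z : ℂ | (-G z).re ≤ (b * ‖z‖ + l) ^ 2} :=
      isClosed_le (Complex.continuous_re.comp hGd.continuous.neg) (by fun_prop)
    intro z
    refine hcl.closure_subset_iff.2 (fun w hw => ?_) (hcount.dense_compl ℝ z)
    have := hre w hw
    change (-G w).re ≤ _
    rw [hGU w hw, Complex.neg_re]
    linarith)
  refine ⟨-a₂ / t ^ 2, -a₁ / t ^ 2, -a₀ / t ^ 2, ?_⟩
  filter_upwards [hSae, hFφ] with x h1 h2
  have h3 := ha x
  rw [hGU x h1, h2] at h3
  field_simp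
  linear_combination -h3

/-! ### Distributions with quadratic Fourier transform -/

theorem fourierInv_derivCLM (χ : 𝓢(ℝ, ℂ)) (ξ : ℝ) :
    (𝓕⁻ (SchwartzMap.derivCLM ℂ ℂ χ) : 𝓢(ℝ, ℂ)) ξ =
      -(2 * Real.pi * Complex.I * ξ) * (𝓕⁻ χ : 𝓢(ℝ, ℂ)) ξ := by
  have h1 : ((SchwartzMap.derivCLM ℂ ℂ χ : 𝓢(ℝ, ℂ)) : ℝ → ℂ) = deriv χ := by
    ext x; rw [derivCLM_apply]
  have h2 : Integrable (deriv χ) := h1 ▸ (SchwartzMap.derivCLM ℂ ℂ χ).integrable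
  rw [fourierInv_coe, fourierInv_coe, h1, Real.fourierInv_eq_fourier_neg,
    Real.fourierInv_eq_fourier_neg, Real.fourier_deriv χ.integrable χ.differentiable h2]
  simp

theorem integral_fourierInv (χ : 𝓢(ℝ, ℂ)) : ∫ ξ, (𝓕⁻ χ : 𝓢(ℝ, ℂ)) ξ = χ 0 := by
  have h : (𝓕 (𝓕⁻ χ : 𝓢(ℝ, ℂ)) : 𝓢(ℝ, ℂ)) 0 = χ 0 := by
    rw [FourierTransform.fourier_fourierInv_eq]
  rw [← h, fourier_coe, Real.fourier_real_eq_integral_exp_smul]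
  simp

/-- The Fourier transform of `-(α δ'' + i β δ' + γ δ)` is `4π²α ξ² + 2πβ ξ - γ`. -/
theorem eq_diffKernel {ν : 𝓢'(ℝ, ℂ)} {m : ℝ → ℂ} {hm : IsTempered m} (hν : 𝓕 ν = regDist m hm)
    {α β γ : ℝ} (h : ∀ᵐ ξ : ℝ, m ξ =
      4 * Real.pi ^ 2 * α * (ξ : ℂ) ^ 2 + 2 * Real.pi * β * ξ - γ) : ν = diffKernel α β γ := by
  ext χ
  set ψ : 𝓢(ℝ, ℂ) := 𝓕⁻ χ
  set χ' : 𝓢(ℝ, ℂ) := SchwartzMap.derivCLM ℂ ℂ χ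
  set χ'' : 𝓢(ℝ, ℂ) := SchwartzMap.derivCLM ℂ ℂ χ'
  have hR : diffKernel α β γ χ = -(α * χ'' 0 - Complex.I * β * χ' 0 + γ * χ 0) := by
    have h1 : TemperedDistribution.derivCLM ℂ (TemperedDistribution.delta (0 : ℝ)) χ = -χ' 0 := by
      rw [TemperedDistribution.derivCLM_apply_apply, TemperedDistribution.delta_apply]
      rfl
    have h2 : TemperedDistribution.derivCLM ℂ (TemperedDistribution.derivCLM ℂ
        (TemperedDistribution.delta (0 : ℝ))) χ = χ'' 0 := by
      rw [TemperedDistribution.derivCLM_apply_apply, TemperedDistribution.derivCLM_apply_apply,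
        TemperedDistribution.delta_apply, map_neg, neg_neg]
    have h3 : diffKernel α β γ χ =
        -((α : ℂ) * TemperedDistribution.derivCLM ℂ (TemperedDistribution.derivCLM ℂ
            (TemperedDistribution.delta (0 : ℝ))) χ
          + (Complex.I * β) * TemperedDistribution.derivCLM ℂ
            (TemperedDistribution.delta (0 : ℝ)) χ
          + γ * TemperedDistribution.delta (0 : ℝ) χ) := rfl
    rw [h3, h1, h2, TemperedDistribution.delta_apply]
    ring
  have hL : ν χ = ∫ ξ, ψ ξ * m ξ := by
    rw [← regDist_apply hm, ← hν, TemperedDistribution.fourier_apply,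
      FourierTransform.fourier_fourierInv_eq]
  have e0 := integral_fourierInv χ
  have e1 := integral_fourierInv χ'
  have e2 := integral_fourierInv χ''
  have hi0 : Integrable ψ := ψ.integrable
  have hi1 : Integrable (𝓕⁻ χ' : 𝓢(ℝ, ℂ)) := (𝓕⁻ χ' : 𝓢(ℝ, ℂ)).integrable
  have hi2 : Integrable (𝓕⁻ χ'' : 𝓢(ℝ, ℂ)) := (𝓕⁻ χ'' : 𝓢(ℝ, ℂ)).integrable
  have hpt : ∀ᵐ ξ : ℝ, ψ ξ * m ξ = -α * (𝓕⁻ χ'' : 𝓢(ℝ, ℂ)) ξ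
      + Complex.I * β * (𝓕⁻ χ' : 𝓢(ℝ, ℂ)) ξ - γ * ψ ξ := by
    filter_upwards [h] with ξ hξ
    rw [hξ, fourierInv_derivCLM, fourierInv_derivCLM]
    -- The underscores stand for the factor `-2πiξ` that each derivative contributes.
    change ψ ξ * _ = -α * (_ * (_ * ψ ξ)) + Complex.I * β * (_ * ψ ξ) - γ * ψ ξ
    linear_combination (4 * Real.pi ^ 2 * α * (ξ : ℂ) ^ 2 * ψ ξ + 2 * Real.pi * β * ξ * ψ ξ) *
      Complex.I_sq
  rw [hR, hL, integral_congr_ae hpt, integral_sub, integral_add, integral_const_mul,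
    integral_const_mul, integral_const_mul, e0, e1, e2]
  · ring
  · exact hi2.const_mul _
  · exact hi1.const_mul _
  · exact (hi2.const_mul _).add (hi1.const_mul _)
  · exact hi0.const_mul _

/-- A quadratic polynomial that is almost everywhere nonnegative on the real line has real
coefficients and nonpositive discriminant. -/
theorem exists_real_coeff_of_nonneg {a₂ a₁ a₀ : ℂ}
    (h : ∀ᵐ x : ℝ, 0 ≤ a₂ * (x : ℂ) ^ 2 + a₁ * x + a₀) :
    ∃ A B C : ℝ, a₂ = A ∧ a₁ = B ∧ a₀ = C ∧
      ((A = 0 ∧ B = 0 ∧ 0 ≤ C) ∨ (0 < A ∧ B ^ 2 - 4 * A * C ≤ 0)) := by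
  have hcl : IsClosed {x : ℝ | 0 ≤ a₂ * (x : ℂ) ^ 2 + a₁ * x + a₀} :=
    isClosed_le continuous_const (by fun_prop)
  have hall : ∀ x : ℝ, 0 ≤ a₂ * (x : ℂ) ^ 2 + a₁ * x + a₀ := fun x =>
    hcl.closure_subset (Measure.dense_of_ae h x)
  have him : ∀ x : ℝ, a₂.im * x ^ 2 + a₁.im * x + a₀.im = 0 := fun x => by
    have := (Complex.nonneg_iff.1 (hall x)).2
    rw [← Complex.ofReal_pow, Complex.add_im, Complex.add_im, Complex.im_mul_ofReal,
      Complex.im_mul_ofReal] at this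
    exact this.symm
  have hre : ∀ x : ℝ, 0 ≤ a₂.re * (x * x) + a₁.re * x + a₀.re := fun x => by
    have := (Complex.nonneg_iff.1 (hall x)).1
    rw [← Complex.ofReal_pow, Complex.add_re, Complex.add_re, Complex.re_mul_ofReal,
      Complex.re_mul_ofReal, sq] at this
    exact this
  have i0 := him 0
  have i1 := him 1
  have i2 := him (-1)
  refine ⟨a₂.re, a₁.re, a₀.re, Complex.ext rfl (by simp; linarith),
    Complex.ext rfl (by simp; linarith), Complex.ext rfl (by simp; linarith), ?_⟩
  have hdisc := discrim_le_zero hre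
  rw [discrim] at hdisc
  have r0 := hre 0
  have r1 := hre 1
  simp only [mul_zero, zero_add, mul_one] at r0 r1
  rcases lt_trichotomy a₂.re 0 with hA | hA | hA
  · exfalso
    have h1 : a₁.re ^ 2 ≤ 0 := by nlinarith
    have h2 : a₁.re = 0 := (pow_eq_zero_iff two_ne_zero).1 (le_antisymm h1 (sq_nonneg _))
    rw [h2] at hdisc
    have h3 : a₀.re ≤ 0 := by nlinarith
    linarith
  · left
    rw [hA] at hdisc
    exact ⟨hA, (pow_eq_zero_iff two_ne_zero).1 (le_antisymm (by linarith) (sq_nonneg _)), r0⟩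
  · exact Or.inr ⟨hA, hdisc⟩

/-! ### Propagators of compact support -/

/-- The Pythagorean identity for the entire extensions of the symbols `cos (t √φ)` and
`sin (t √φ) / √φ` reads `C² + φ S² = 1`. -/
theorem exists_quadratic_of_compactSupport {φ : ℝ → ℂ} (hφ : AEStronglyMeasurable φ)
    (h0 : ∀ᵐ ξ, 0 ≤ φ ξ) {t : ℝ} (ht : 0 < t)
    (hc : CompactSupport (𝓕⁻ (regDist _ (isTempered_cosSymbol hφ t))))
    (hs : CompactSupport (𝓕⁻ (regDist _ (isTempered_sinSymbol hφ t))))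
    (hne : 𝓕⁻ (regDist _ (isTempered_sinSymbol hφ t)) ≠ 0) :
    ∃ a₂ a₁ a₀ : ℂ, ∀ᵐ x : ℝ, φ x = a₂ * (x : ℂ) ^ 2 + a₁ * x + a₀ := by
  obtain ⟨C, hC, ⟨K, b, hK, hb, hbound⟩, hCe⟩ := exists_entire_of_compactSupport zero_le_one
    (norm_cosSymbol_le φ t) (FourierTransform.fourier_fourierInv_eq _) hc
  obtain ⟨S, hS, -, hSe⟩ := exists_entire_of_compactSupport (abs_nonneg t)
    (norm_sinSymbol_le φ t) (FourierTransform.fourier_fourierInv_eq _) hs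
  refine exists_quadratic_of_entire ht hC hS ?_ hK hb hbound ?_ ?_
  · by_contra! hS0
    refine hne ?_
    have : regDist _ (isTempered_sinSymbol hφ t) = 0 := by
      ext χ
      rw [regDist_apply, integral_eq_zero_of_ae]
      · rfl
      · filter_upwards [hSe] with x hx
        rw [← hx, hS0, mul_zero]
        rfl
    rw [this]
    exact map_zero (FourierTransform.fourierInvCLM ℂ 𝓢'(ℝ, ℂ))
  · filter_upwards [hCe, hSe, h0] with x h1 h2 h3
    have h4 := sinSymbol_mul_freq φ t x
    rw [h1, h2, ← ofReal_freq_sq h3, mul_comm, ← mul_pow, h4, cosSymbol, ← Complex.ofReal_pow,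
      ← Complex.ofReal_pow, ← Complex.ofReal_add, Real.cos_sq_add_sin_sq, Complex.ofReal_one]
  · filter_upwards [hCe, h0] with x h1 h3
    rw [h1, ← ofReal_freq_sq h3, ← mul_pow, cosSqrt_sq, cosSymbol]
    push_cast
    rfl

/-- If `sin (t √φ) / √φ` vanishes almost everywhere and `φ` is continuous, then `√φ` takes values in
a discrete set, so `φ` is constant. -/
theorem exists_const_of_sinSymbol_eq_zero {φ : ℝ → ℂ} (hφ : Continuous φ) (h0 : ∀ᵐ ξ, 0 ≤ φ ξ)
    {t : ℝ} (ht : 0 < t) (h : ∀ᵐ ξ, sinSymbol φ t ξ = 0) : ∃ c : ℂ, ∀ x, φ x = c := by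
  have hall : ∀ x : ℝ, 0 ≤ φ x := fun x =>
    (isClosed_le continuous_const hφ : IsClosed {x | 0 ≤ φ x}).closure_subset
      (Measure.dense_of_ae h0 x)
  have hr : Continuous (freq φ) := Real.continuous_sqrt.comp (Complex.continuous_re.comp hφ)
  have hsin : ∀ x, Complex.sin (t * freq φ x) = 0 := by
    have hcl : IsClosed {x : ℝ | Complex.sin (t * freq φ x) = 0} :=
      isClosed_eq (by fun_prop) continuous_const
    refine fun x => hcl.closure_subset (Measure.dense_of_ae (μ := volume) ?_ x)
    filter_upwards [h] with x hx
    have h1 := sinSymbol_mul_freq φ t x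
    rw [hx, zero_mul] at h1
    rw [h1]
    push_cast
    rfl
  have hZ : {s : ℝ | Complex.sin (t * s) = 0}.Countable := by
    refine (countable_zeros (S := fun z => Complex.sin (t * z)) (by fun_prop)
      ⟨Real.pi / 2 / t, ?_⟩).preimage Complex.ofReal_injective
    rw [mul_div_cancel₀ _ (Complex.ofReal_ne_zero.2 ht.ne'), Complex.sin_pi_div_two]
    exact one_ne_zero
  have hle : ∀ x y, freq φ x ≤ freq φ y := by
    by_contra! hxy
    obtain ⟨x, y, hxy⟩ := hxy
    obtain ⟨s, hs, hs'⟩ := (hZ.dense_compl ℝ).exists_between hxy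
    obtain ⟨w, rfl⟩ := intermediate_value_univ y x hr ⟨hs'.1.le, hs'.2.le⟩
    exact hs (hsin w)
  refine ⟨φ 0, fun x => ?_⟩
  rw [← ofReal_freq_sq (hall x), ← ofReal_freq_sq (hall 0), le_antisymm (hle x 0) (hle 0 x)]

end NonlocalWave

end

open NonlocalWave Filter

theorem theorem3 (ν : 𝓢'(ℝ, ℂ)) (φ : ℝ → ℂ) (hφ : NonlocalWave.IsFunction (𝓕 ν) φ)
    (hpos : ∀ χ : 𝓢(ℝ, ℂ), 0 ≤ NonlocalWave.pair (NonlocalWave.conv ν χ) χ)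
    (hsa : ∀ χ₁ χ₂ : 𝓢(ℝ, ℂ),
      NonlocalWave.pair (NonlocalWave.conv ν χ₁) χ₂
        = NonlocalWave.pair χ₁ (NonlocalWave.conv ν χ₂)) :
    ∃ k₀ kneg : ℝ → 𝓢'(ℝ, ℂ),
      (∀ u₀ u₁ : 𝓢(ℝ, ℂ),
        (∃! u : ℝ → 𝓢'(ℝ, ℂ), NonlocalWave.IsSolution ν u₀ u₁ u) ∧
        ∀ u : ℝ → 𝓢'(ℝ, ℂ), NonlocalWave.IsSolution ν u₀ u₁ u →
          ∀ t : ℝ, NonlocalWave.IsFunction (u t)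
            (fun x => NonlocalWave.conv (k₀ t) u₀ x + NonlocalWave.conv (kneg t) u₁ x)) ∧
      (∀ t : ℝ, 0 < t →
        NonlocalWave.CompactSupport (k₀ t) → NonlocalWave.CompactSupport (kneg t) →
        (kneg t ≠ 0 ∨ Continuous φ) →
        ∃ α β γ : ℝ, ν = NonlocalWave.diffKernel α β γ ∧
          ((α = 0 ∧ β = 0 ∧ γ ≤ 0) ∨ (0 < α ∧ 4 * α * γ + β ^ 2 ≤ 0))) := by
  have h0 := symbol_nonneg hφ hpos
  have hT := isTempered_of_nonneg hφ h0
  have hm := hT.aestronglyMeasurable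
  refine ⟨fun t => 𝓕⁻ (regDist _ (isTempered_cosSymbol hm t)),
    fun t => 𝓕⁻ (regDist _ (isTempered_sinSymbol hm t)), fun u₀ u₁ => ?_, fun t ht hc hs hor => ?_⟩
  · have hsol := isSolution_fourierInv_solHat hφ hT h0 u₀ u₁
    refine ⟨⟨_, hsol, fun u hu => isSolution_unique hφ hu hsol⟩, fun u hu t => ?_⟩
    rw [isSolution_unique hφ hu hsol]
    exact isFunction_fourierInv_solHat hm u₀ u₁ t
  · -- If `k₋₁(t) = 0`, continuity of `φ` makes it constant; otherwise the entire extensions of the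
    -- symbols apply.
    have hquad : ∃ a₂ a₁ a₀ : ℂ, ∀ᵐ x : ℝ, φ x = a₂ * (x : ℂ) ^ 2 + a₁ * x + a₀ := by
      by_cases hne : 𝓕⁻ (regDist _ (isTempered_sinSymbol hm t)) = 0
      · have hz : regDist _ (isTempered_sinSymbol hm t) = 0 := by
          rw [← FourierTransform.fourier_fourierInv_eq (E := 𝓢'(ℝ, ℂ)) (F := 𝓢'(ℝ, ℂ))
            (regDist _ (isTempered_sinSymbol hm t)), hne]
          exact map_zero (FourierTransform.fourierCLM ℂ 𝓢'(ℝ, ℂ))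
        have hae : sinSymbol φ t =ᵐ[volume] fun _ => 0 := by
          refine (isFunction_regDist (isTempered_sinSymbol hm t)).ae_eq ?_
          rw [hz]
          exact ⟨locallyIntegrable_const 0, fun χ _ => by simp⟩
        obtain ⟨c, hcc⟩ := exists_const_of_sinSymbol_eq_zero
          (hor.resolve_left (not_not.2 hne)) h0 ht hae
        exact ⟨0, 0, c, Eventually.of_forall fun x => by simp [hcc]⟩
      · exact exists_quadratic_of_compactSupport hm h0 ht hc hs hne
    obtain ⟨a₂, a₁, a₀, ha⟩ := hquad
    obtain ⟨A, B, C, rfl, rfl, rfl, hABC⟩ := exists_real_coeff_of_nonneg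
      (a₂ := a₂) (a₁ := a₁) (a₀ := a₀) (by
        filter_upwards [ha, h0] with x h1 h2
        rwa [← h1])
    have hpi := Real.pi_pos
    refine ⟨A / (4 * Real.pi ^ 2), B / (2 * Real.pi), -C, eq_diffKernel (hφ.eq_regDist hT) ?_, ?_⟩
    · filter_upwards [ha] with x hx
      have : (Real.pi : ℂ) ≠ 0 := Complex.ofReal_ne_zero.2 hpi.ne'
      rw [hx]
      push_cast
      field_simp
      ring
    · refine hABC.imp ?_ ?_
      · rintro ⟨rfl, rfl, hC⟩
        exact ⟨by simp, by simp, by linarith⟩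
      · rintro ⟨hA, hd⟩
        refine ⟨by positivity, ?_⟩
        have : 4 * (A / (4 * Real.pi ^ 2)) * -C + (B / (2 * Real.pi)) ^ 2 =
            (B ^ 2 - 4 * A * C) / (4 * Real.pi ^ 2) := by field_simp; ring
        rw [this]
        exact div_nonpos_of_nonpos_of_nonneg hd (by positivity)
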